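/- For $n\ge 3$ let $G_n$ be the graph with vertices $0,1,\dots,2n+5$ and the following edges: $\{i,i+3\}$ for $0\le i\le 2n+2$; the edges of a triangle on $\{0,1,2\}$ (the cap); the edge $\{2k+1,2k+2\}$ for $1\le k\le n$ (the $k$-th gadget); and the edges of a triangle on $\{2n+3,2n+4,2n+5\}$ (the pac). Let $C_0$ be the Hamiltonian cycle of $G_n$ that consists of the edges $\{i,i+3\}$ with $i$ even, the edges $\{i,i+1\}$ with $i$ odd, and the edges $\{0,1\}$ and $\{2n+4,2n+5\}$. Let $C_1$ be the Hamiltonian cycle of $G_n$ that consists of the edges $\{i,i+3\}$ with $i$ odd or $4\mid i$, the edges $\{i,i+1\}$ with $i\equiv 1 \pmod 4$, the edges $\{0,2\}$ and $\{2n+3,2n+5\}$, and, if $n$ is even, the edge $\{2n+4,2n+5\}$. (All indices are such that the edges lie in $\{0,\dots,2n+5\}$.) Thomason's lollipop algorithm on a cubic graph $G$ with $N$ vertices, a Hamiltonian cycle $C$ and an oriented edge $v_1v_2$ of $C$ starts with the Hamiltonian path $v_1,v_2,\dots,v_N$ that runs once around $C$. One step (a lollipop) replaces the current Hamiltonian path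 $v_1,\dots,v_N$ by $v_1,\dots,v_i,v_N,v_{N-1},\dots,v_{i+1}$, where $1<i<N-1$ and $v_i$ is adjacent to $v_N$; a step never returns to the path that the previous step left. The algorithm stops as soon as, after at least one step, the last vertex of the current path is adjacent to the first one, so that the path closes up to a Hamiltonian cycle. **Theorem.** For every $n\ge 3$ the graph $G_n$ is cubic, 3-connected and planar, and Thomason's algorithm on $G_n$, started with $C_0$ and the edge from $0$ to $3$ (the green edge), has exactly one run; this run terminates, with the cycle $C_1$. The number of its steps is $\Theta(c^n)$ as $n\to\infty$, where $1/c$ is the root of smallest modulus of $z^4+2z^3-1$; all other complex roots have larger modulus. Here $c\approx 1.3953$. As $G_n$ has $2n+6$ vertices, the number of steps is $\Theta\big((\sqrt c)^{|V(G_n)|}\big)$ with $\sqrt c\approx 1.1812$. -/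

import Mathlib

open Asymptotics Filter

namespace Thomason

section General

variable {V : Type*}

/-- An oriented Hamiltonian path `v₁, v₂, …, v_N` of `G`, as the list of its vertices in order:
no vertex is repeated, every vertex occurs, consecutive vertices are adjacent. -/
def IsHamPath (G : SimpleGraph V) (P : List V) : Prop :=
  P.Nodup ∧ (∀ v, v ∈ P) ∧ P.IsChain G.Adj

/-- The path `P` (with at least three vertices) closes up to a cycle: its last vertex is adjacent
to its first vertex. -/
def Closes (G : SimpleGraph V) (P : List V) : Prop :=
  ∃ (a : V) (M : List V) (b : V), P = a :: (M ++ [b]) ∧ M ≠ [] ∧ G.Adj b a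

/-- The edge set of the closed walk `v₁, v₂, …, v_N, v₁`. -/
def cycleEdges (P : List V) : Set (Sym2 V) :=
  {e | ∃ q ∈ P.zip (P.rotate 1), e = s(q.1, q.2)}

/-- One lollipop. `P = v₁, …, v_N` is an oriented Hamiltonian path, its last vertex `v_N` is
adjacent to `v_i`, where `1 < i < N - 1`, and `Q = v₁, …, v_i, v_N, v_{N-1}, …, v_{i+1}`.
Here `A = v₁, …, v_{i-1}`, `v = v_i`, `B = v_{i+1}, …, v_{N-1}` and `e = v_N`. -/
def Lollipop (G : SimpleGraph V) (P Q : List V) : Prop :=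
  IsHamPath G P ∧ ∃ (A : List V) (v : V) (B : List V) (e : V),
    A ≠ [] ∧ B ≠ [] ∧ G.Adj v e ∧
      P = A ++ v :: (B ++ [e]) ∧ Q = A ++ v :: (e :: B.reverse)

/-- `p 0, p 1, …, p T` is a complete run, with `T` lollipop steps, of Thomason's algorithm in `G`
on the Hamiltonian cycle with edge set `C` and its distinguished edge `ab`, oriented from `a` to
`b`. (Values `p k` with `k > T` play no role.)

The run begins with the Hamiltonian path that starts `a, b, …` and runs once around `C`. In each
step the current path is lollipopped, never back to the path just left, and the run
stops as soon as the current path closes up to a Hamiltonian cycle again. -/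
structure IsRun (G : SimpleGraph V) (C : Set (Sym2 V)) (a b : V) (T : ℕ) (p : ℕ → List V) :
    Prop where
  start_path : IsHamPath G (p 0)
  start_edge : [a, b] <+: p 0
  start_closes : Closes G (p 0)
  start_cycle : cycleEdges (p 0) = C
  pos : 0 < T
  step : ∀ k, k < T → Lollipop G (p k) (p (k + 1))
  no_return : ∀ k, k + 1 < T → p (k + 2) ≠ p k
  running : ∀ k, 0 < k → k < T → ¬ Closes G (p k)
  finish : Closes G (p T)

/-- 3-connectedness: more than three vertices, and deleting fewer than three vertices always
leaves a connected graph. -/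
def IsThreeConnected [Fintype V] (G : SimpleGraph V) : Prop :=
  3 < Fintype.card V ∧
    ∀ S : Finset V, S.card < 3 → (G.induce ((S : Set V)ᶜ)).Connected

/-- Planarity: `G` can be drawn in the plane, with distinct points for the vertices and with a
simple arc between its two ends for each edge, so that an arc contains no vertices but its ends
and two distinct arcs meet only in common ends. -/
def IsPlanar (G : SimpleGraph V) : Prop :=
  ∃ (pt : V → ℝ × ℝ) (curve : Sym2 V → Set (ℝ × ℝ)),
    Function.Injective pt ∧
    (∀ u v, G.Adj u v →
      ∃ γ : Path (pt u) (pt v), Function.Injective γ ∧ Set.range γ = curve s(u, v)) ∧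
    (∀ e ∈ G.edgeSet, ∀ w, pt w ∈ curve e → w ∈ e) ∧
    (∀ e ∈ G.edgeSet, ∀ f ∈ G.edgeSet, e ≠ f →
      curve e ∩ curve f ⊆ pt '' {w | w ∈ e ∧ w ∈ f})

end General

/-- The graph `G_n` on the vertices `0, 1, …, 2n + 5`.

The cap is the triangle `{0, 1, 2}`, the `k`-th gadget (`1 ≤ k ≤ n`) is the pair
`{2k + 1, 2k + 2}`, and the pac is the triangle `{2n + 3, 2n + 4, 2n + 5}`. The components are
strung on three strands, the residue classes modulo 3: each `i` is joined to `i + 3`. Thus each two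
consecutive components are separated by a cut of three edges, one on each strand; two of the three
strands entering a gadget run through its two vertices, and the third passes by. -/
def G (n : ℕ) : SimpleGraph (Fin (2 * n + 6)) :=
  SimpleGraph.fromRel fun i j =>
    -- the three strands
    j.val = i.val + 3 ∨
    -- the edge inside the gadget `{i, j} = {2k + 1, 2k + 2}`, where `1 ≤ k ≤ n`
    (i.val % 2 = 1 ∧ 3 ≤ i.val ∧ i.val ≤ 2 * n + 1 ∧ j.val = i.val + 1) ∨
    -- the triangle of the cap
    (i.val < 3 ∧ j.val < 3) ∨
    -- the triangle of the pac
    (2 * n + 3 ≤ i.val ∧ 2 * n + 3 ≤ j.val)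

instance (n : ℕ) : DecidableRel (G n).Adj := fun i j => by
  unfold G
  simp only [SimpleGraph.fromRel_adj]
  infer_instance

/-- The edge set of the initial Hamiltonian cycle of `G_n`: all edges `{i, i + 3}` with `i` even,
all edges `{i, i + 1}` with `i` odd, and the edges `{0, 1}` and `{2n + 4, 2n + 5}`. -/
def C₀ (n : ℕ) : Set (Sym2 (Fin (2 * n + 6))) :=
  {e | ∃ i j : Fin (2 * n + 6), e = s(i, j) ∧
    ((i.val % 2 = 0 ∧ j.val = i.val + 3) ∨
     (i.val % 2 = 1 ∧ j.val = i.val + 1) ∨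
     (i.val = 0 ∧ j.val = 1) ∨
     (i.val = 2 * n + 4 ∧ j.val = 2 * n + 5))}

/-- The edge set of the final Hamiltonian cycle of `G_n`: all edges `{i, i + 3}` with `i` odd or
divisible by 4, all edges `{i, i + 1}` with `i ≡ 1` modulo 4, the edges `{0, 2}` and
`{2n + 3, 2n + 5}`, and, if `n` is even, the edge `{2n + 4, 2n + 5}`. -/
def C₁ (n : ℕ) : Set (Sym2 (Fin (2 * n + 6))) :=
  {e | ∃ i j : Fin (2 * n + 6), e = s(i, j) ∧
    (((i.val % 2 = 1 ∨ i.val % 4 = 0) ∧ j.val = i.val + 3) ∨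
     (i.val % 4 = 1 ∧ j.val = i.val + 1) ∨
     (i.val = 0 ∧ j.val = 2) ∨
     (i.val = 2 * n + 3 ∧ j.val = 2 * n + 5) ∨
     (n % 2 = 0 ∧ i.val = 2 * n + 4 ∧ j.val = 2 * n + 5))}

/-- The special vertex of the cap, at which all the Hamiltonian paths of the run start. -/
def lam (n : ℕ) : Fin (2 * n + 6) := ⟨0, by omega⟩

/-- The other end of the distinguished (green) edge. -/
def greenEnd (n : ℕ) : Fin (2 * n + 6) := ⟨3, by omega⟩

end Thomason

-- The graph is self-similar. Cutting off the cap and some gadgets leaves a tail of `m` gadgets and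
-- the pac, joined to the rest by three strand edges. Passing one more gadget cyclically shifts the
-- roles of these edges and decreases `m` by one. In the run, a tail is only ever filled by one of
-- three traversals `travAB`, `travAC`, `travBC` or their reverses, and each excursion of the path
-- end into the tail replaces one traversal by another. Five types of excursion (`Excursions`)
-- reduce to one another at depth `m - 1`, with a few extra steps at the gadget (`excursions_succ`);
-- for the pac they are explicit (`excursions_zero`).
--
-- Two observations make the recursion work. A lollipop step is reversible, so an excursion may be
-- used backwards. And a step depends only on adjacencies at the attaching vertex, so the parts of
-- the path outside the tail may be arbitrary lists `X` and `M`.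
--
-- The whole run is a backward excursion of type `a` at full depth (`exists_isRun`). Its
-- intermediate paths end outside the cap, so none of them closes up early. In a cubic graph the end
-- of a path never has more than one admissible continuation, whence uniqueness (`IsRun.unique`).
-- Eliminating four of the five step counts gives `a (m + 4) = 2 * a (m + 1) + a m + 8`
-- (`stepsA_add_four`), with characteristic equation `c ^ 4 = 2 * c + 1`.
--
-- Three-connectedness holds because two deleted vertices leave one strand intact. For planarity,
-- the strands are drawn on three rays and all other edges as segments between two rays at equal
-- level, so that these form nested layers.

namespace Thomason

-- Reversible lollipop steps and their concatenation

section Runs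

variable {V : Type*} {G : SimpleGraph V}

/-- A lollipop step in which the end of the path is attached to the vertex `v`. -/
def Attach (G : SimpleGraph V) (v : V) (P Q : List V) : Prop :=
  ∃ (A : List V) (b : V) (B : List V) (e : V), A ≠ [] ∧ G.Adj v b ∧ G.Adj v e ∧
    P = A ++ v :: b :: (B ++ [e]) ∧ Q = A ++ v :: e :: (B.reverse ++ [b])

/-- The new end `b` was the successor of `v`, so attaching it to `v` undoes the step. This is why
`Attach` records the edge `vb` as well. -/
theorem Attach.symm {v : V} {P Q : List V} (h : Attach G v P Q) : Attach G v Q P := by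
  obtain ⟨A, b, B, e, hA, hb, he, rfl, rfl⟩ := h
  exact ⟨A, e, B.reverse, b, hA, he, hb, rfl, by simp⟩

theorem Attach.map {W : Type*} {H : SimpleGraph W} (f : V → W)
    (hf : ∀ i j, G.Adj i j → H.Adj (f i) (f j)) {v : V} {P Q : List V} (h : Attach G v P Q) :
    Attach H (f v) (P.map f) (Q.map f) := by
  obtain ⟨A, b, B, e, hA, hb, he, rfl, rfl⟩ := h
  exact ⟨A.map f, f b, B.map f, f e, by simpa using hA, hf _ _ hb, hf _ _ he, by simp, by simp⟩

theorem Attach.perm {v : V} {P Q : List V} (h : Attach G v P Q) : P.Perm Q := by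
  obtain ⟨A, b, B, e, hA, hb, he, rfl, rfl⟩ := h
  refine List.Perm.append_left _ (List.Perm.cons _ ?_)
  have : e :: (B.reverse ++ [b]) = (b :: (B ++ [e])).reverse := by simp
  rw [this]
  exact (List.reverse_perm _).symm

theorem Attach.isHamPath {v : V} {P Q : List V} (h : Attach G v P Q) (hP : IsHamPath G P) :
    IsHamPath G Q := by
  refine ⟨h.perm.nodup_iff.1 hP.1, fun w => h.perm.mem_iff.1 (hP.2.1 w), ?_⟩
  have hc := hP.2.2
  obtain ⟨A, b, B, e, hA, hb, he, rfl, rfl⟩ := h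
  have hQ : A ++ v :: e :: (B.reverse ++ [b]) = (A ++ [v]) ++ (b :: (B ++ [e])).reverse := by simp
  have hP' : A ++ v :: b :: (B ++ [e]) = (A ++ [v]) ++ (b :: (B ++ [e])) := by simp
  rw [hP', List.isChain_append] at hc
  rw [hQ, List.isChain_append]
  refine ⟨hc.1, ?_, ?_⟩
  · rw [List.isChain_reverse]
    exact hc.2.1.imp fun _ _ h => h.symm
  · intro x hx y hy
    simp at hx hy
    subst hx hy
    exact he

theorem Attach.prefix {v : V} {P Q : List V} (h : Attach G v P Q) {x y : V}
    (hP : [x, y] <+: P) : [x, y] <+: Q := by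
  obtain ⟨A, b, B, e, hA, hb, he, rfl, rfl⟩ := h
  obtain _ | ⟨a, _ | ⟨a', A⟩⟩ := A
  · exact absurd rfl hA
  · simpa [List.cons_prefix_cons] using hP
  · simpa [List.cons_prefix_cons] using hP

theorem Attach.lollipop {v : V} {P Q : List V} (h : Attach G v P Q) (hP : IsHamPath G P) :
    Lollipop G P Q := by
  obtain ⟨A, b, B, e, hA, hb, he, rfl, rfl⟩ := h
  exact ⟨hP, A, v, b :: B, e, hA, by simp, he, by simp, by simp⟩

theorem Lollipop.exists_attach {P Q : List V} (h : Lollipop G P Q) : ∃ v, Attach G v P Q := by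
  obtain ⟨hP, A, v, B, e, hA, hB, he, rfl, rfl⟩ := h
  obtain _ | ⟨b, B⟩ := B
  · exact absurd rfl hB
  have hc := hP.2.2
  rw [List.isChain_append] at hc
  refine ⟨v, A, b, B, e, hA, ?_, he, by simp, by simp⟩
  have := hc.2.1
  simp at this
  exact this.1

theorem eq_of_nodup_append_cons {A A' R R' : List V} {v : V} (hn : (A ++ v :: R).Nodup)
    (h : A ++ v :: R = A' ++ v :: R') : A = A' ∧ R = R' := by
  induction A generalizing A' with
  | nil =>
    cases A' with
    | nil => simpa using h
    | cons a A' =>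
      simp at h hn
      obtain ⟨rfl, rfl⟩ := h
      simp at hn
  | cons a A ih =>
    cases A' with
    | nil =>
      simp at h hn
      obtain ⟨rfl, rfl⟩ := h
      simp at hn
    | cons a' A' =>
      simp only [List.cons_append, List.cons.injEq] at h hn
      obtain ⟨rfl, h⟩ := h
      obtain ⟨rfl, rfl⟩ := ih (List.nodup_cons.1 hn).2 h
      simp

/-- A vertex of a path without repetitions has only one predecessor. -/
theorem pred_unique {A A' R R' : List V} {v w x : V} (hn : (A ++ v :: x :: R).Nodup)
    (h : A ++ v :: x :: R = A' ++ w :: x :: R') : v = w := by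
  have h' : (A ++ [v]) ++ x :: R = (A' ++ [w]) ++ x :: R' := by simpa using h
  have := (eq_of_nodup_append_cons (by simpa using hn) h').1
  simpa using congrArg List.getLast? this

theorem Attach.target_unique {v : V} {P Q Q' : List V} (hP : P.Nodup) (h : Attach G v P Q)
    (h' : Attach G v P Q') : Q = Q' := by
  obtain ⟨A, b, B, e, hA, hb, he, rfl, rfl⟩ := h
  obtain ⟨A', b', B', e', hA', hb', he', hPP, rfl⟩ := h'
  obtain ⟨rfl, h⟩ := eq_of_nodup_append_cons hP hPP
  have := congrArg List.reverse h
  simp at this h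
  simp [this]

/-- The last vertex of `P` directly follows the attaching vertex in `Q`. Hence consecutive steps
that attach to different vertices never return to the path just left. -/
theorem Attach.vertex_unique {v w : V} {P Q : List V} (hP : P.Nodup) (h : Attach G v P Q)
    (h' : Attach G w P Q) : v = w := by
  have hQ := h.perm.nodup_iff.1 hP
  obtain ⟨A, b, B, e, hA, hb, he, rfl, rfl⟩ := h
  obtain ⟨A', b', B', e', hA', hb', he', hPP, hQQ⟩ := h'
  have : e = e' := by
    simpa [List.getLast?_append, List.getLast?_cons] using congrArg List.getLast? hPP
  subst this
  exact pred_unique hQ hQQ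

/-- `Run G good k v w P Q`: there is a sequence of `k` lollipop steps from `P` to `Q`, the first one
attaching to `v` and the last one to `w`, in which consecutive steps attach to different vertices,
and all paths strictly between `P` and `Q` end in a vertex satisfying `good`. -/
inductive Run (G : SimpleGraph V) (good : V → Prop) : ℕ → V → V → List V → List V → Prop
  | single {v : V} {P Q : List V} : Attach G v P Q → Run G good 1 v v P Q
  | trans {k l : ℕ} {v w v' w' : V} {P Q R : List V} : Run G good k v w P Q →
      Run G good l v' w' Q R → w ≠ v' → (∀ x ∈ Q.getLast?, good x) → Run G good (k + l) v w' P R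

theorem Run.symm {good : V → Prop} {k : ℕ} {v w : V} {P Q : List V} (h : Run G good k v w P Q) :
    Run G good k w v Q P := by
  induction h with
  | single h => exact .single h.symm
  | trans _ _ hne hg ih₁ ih₂ =>
    rw [add_comm]
    exact .trans ih₂ ih₁ hne.symm hg

theorem Run.mono {good good' : V → Prop} (hg : ∀ x, good x → good' x) {k : ℕ} {v w : V}
    {P Q : List V} (h : Run G good k v w P Q) : Run G good' k v w P Q := by
  induction h with
  | single h => exact .single h
  | trans _ _ hne h ih₁ ih₂ => exact .trans ih₁ ih₂ hne fun x hx => hg x (h x hx)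

theorem Run.exists_seq {good : V → Prop} {k : ℕ} {v w : V} {P Q : List V}
    (h : Run G good k v w P Q) :
    ∃ (p : ℕ → List V) (a : ℕ → V), p 0 = P ∧ p k = Q ∧ a 0 = v ∧ a (k - 1) = w ∧ 0 < k ∧
      (∀ i < k, Attach G (a i) (p i) (p (i + 1))) ∧ (∀ i, i + 1 < k → a i ≠ a (i + 1)) ∧
      ∀ i, 0 < i → i < k → ∀ x ∈ (p i).getLast?, good x := by
  induction h with
  | @single v P Q h =>
    refine ⟨fun i => if i = 0 then P else Q, fun _ => v, by simp, by simp, rfl, rfl, one_pos, ?_,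
      by omega, by omega⟩
    intro i hi
    obtain rfl : i = 0 := by omega
    simpa using h
  | @trans k l v w v' w' P Q R _ _ hne hg ih₁ ih₂ =>
    obtain ⟨p, a, hp0, hpk, ha0, hak, hk, hs, hn, hh⟩ := ih₁
    obtain ⟨p', a', hp0', hpk', ha0', hak', hk', hs', hn', hh'⟩ := ih₂
    refine ⟨fun i => if i ≤ k then p i else p' (i - k), fun i => if i < k then a i else a' (i - k),
      by simp [hp0], ?_, by simp [hk, ha0], ?_, by omega, ?_, ?_, ?_⟩
    · simp [hpk', hk'.ne']
    · have : k + l - 1 - k = l - 1 := by omega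
      simp [show ¬ (k + l - 1 < k) by omega, this, hak']
    · intro i hi
      rcases lt_or_ge i k with h | h
      · simpa [h, h.le, Nat.succ_le_of_lt h] using hs i h
      · obtain ⟨j, rfl⟩ := Nat.exists_eq_add_of_le h
        have := hs' j (by omega)
        rcases Nat.eq_zero_or_pos j with rfl | hj
        · simpa [hpk, hp0'] using this
        · simpa [hj.ne', add_assoc] using this
    · intro i hi
      rcases lt_or_ge (i + 1) k with h | h
      · simpa [h, (show i < k by omega)] using hn i h
      · rcases Nat.eq_or_lt_of_le h with h | h
        -- At the junction, the last step of the first run meets the first step of the second; this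
        -- is where `w ≠ v'` is needed.
        · obtain rfl : i = k - 1 := by omega
          simpa [show k - 1 + 1 = k by omega, hk, hak, ha0'] using hne
        · obtain ⟨j, rfl⟩ := Nat.exists_eq_add_of_le (show k ≤ i by omega)
          simpa [add_assoc] using hn' j (by omega)
    · intro i hi0 hi
      rcases lt_trichotomy i k with h | rfl | h
      · simpa [h.le] using hh i hi0 h
      · simpa [hpk] using hg
      · obtain ⟨j, rfl⟩ := Nat.exists_eq_add_of_le h.le
        simpa [show j ≠ 0 by omega] using hh' j (by omega) (by omega)

end Runs

-- Traversals of a tail and the recursion of excursions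

/-- The graph `G n`, on the natural numbers. -/
def natGraph (n : ℕ) : SimpleGraph ℕ := (G n).map Fin.valEmbedding

theorem G_adj {n : ℕ} {i j : Fin (2 * n + 6)} :
    (G n).Adj i j ↔ i.val ≠ j.val ∧
      ((j.val = i.val + 3 ∨
        (i.val % 2 = 1 ∧ 3 ≤ i.val ∧ i.val ≤ 2 * n + 1 ∧ j.val = i.val + 1) ∨
        (i.val < 3 ∧ j.val < 3) ∨ (2 * n + 3 ≤ i.val ∧ 2 * n + 3 ≤ j.val)) ∨
       (i.val = j.val + 3 ∨
        (j.val % 2 = 1 ∧ 3 ≤ j.val ∧ j.val ≤ 2 * n + 1 ∧ i.val = j.val + 1) ∨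
        (j.val < 3 ∧ i.val < 3) ∨ (2 * n + 3 ≤ j.val ∧ 2 * n + 3 ≤ i.val))) := by
  rw [G, SimpleGraph.fromRel_adj, Ne, Fin.ext_iff]

theorem natGraph_adj {n i j : ℕ} :
    (natGraph n).Adj i j ↔ i < 2 * n + 6 ∧ j < 2 * n + 6 ∧ i ≠ j ∧
      ((j = i + 3 ∨ (i % 2 = 1 ∧ 3 ≤ i ∧ i ≤ 2 * n + 1 ∧ j = i + 1) ∨
        (i < 3 ∧ j < 3) ∨ (2 * n + 3 ≤ i ∧ 2 * n + 3 ≤ j)) ∨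
       (i = j + 3 ∨ (j % 2 = 1 ∧ 3 ≤ j ∧ j ≤ 2 * n + 1 ∧ i = j + 1) ∨
        (j < 3 ∧ i < 3) ∨ (2 * n + 3 ≤ j ∧ 2 * n + 3 ≤ i))) := by
  rw [natGraph, SimpleGraph.map_adj]
  constructor
  · rintro ⟨a, b, h, rfl, rfl⟩
    exact ⟨a.2, b.2, G_adj.1 h⟩
  · rintro ⟨hi, hj, h⟩
    exact ⟨⟨i, hi⟩, ⟨j, hj⟩, G_adj.2 h, rfl, rfl⟩

mutual

/-- The traversal of the vertices `t + 3, …, t + 2 * m + 5` (the last `m` gadgets and the pac) that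
begins at `t + 3` and ends at `t + 4`. -/
def travAB : ℕ → ℕ → List ℕ
  | 0, t => [t + 3, t + 5, t + 4]
  | m + 1, t => (t + 3) :: (travBC m (t + 2) ++ [t + 4])

/-- The traversal of `t + 3, …, t + 2 * m + 5` that begins at `t + 3` and ends at `t + 5`. -/
def travAC : ℕ → ℕ → List ℕ
  | 0, t => [t + 3, t + 4, t + 5]
  | m + 1, t => (t + 3) :: (t + 4) :: (travAC m (t + 2)).reverse

/-- The traversal of `t + 3, …, t + 2 * m + 5` that begins at `t + 4` and ends at `t + 5`. -/
def travBC : ℕ → ℕ → List ℕ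
  | 0, t => [t + 4, t + 3, t + 5]
  | m + 1, t => (t + 4) :: (t + 3) :: (travAB m (t + 2)).reverse

end

theorem trav_ends (m t : ℕ) :
    (∃ L, travAB m t = (t + 3) :: (L ++ [t + 4])) ∧ (∃ L, travAC m t = (t + 3) :: (L ++ [t + 5])) ∧
      ∃ L, travBC m t = (t + 4) :: (L ++ [t + 5]) := by
  induction m generalizing t with
  | zero => exact ⟨⟨[t + 5], rfl⟩, ⟨[t + 4], rfl⟩, ⟨[t + 3], rfl⟩⟩
  | succ m ih =>
    obtain ⟨⟨L₁, h₁⟩, ⟨L₂, h₂⟩, ⟨L₃, h₃⟩⟩ := ih (t + 2)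
    refine ⟨⟨travBC m (t + 2), by rw [travAB]⟩, ⟨(t + 4) :: (t + 7) :: L₂.reverse, ?_⟩,
      ⟨(t + 3) :: (t + 6) :: L₁.reverse, ?_⟩⟩
    · rw [travAC, h₂]; simp [add_assoc]
    · rw [travBC, h₁]; simp [add_assoc]

mutual

/-- The number of steps of an excursion of the path end into the last `m` gadgets and the pac, while
three edges join them to the rest of the graph, and the path enters them from `v₁` on the first
edge. -/
def stepsA : ℕ → ℕ
  | 0 => 3
  | m + 1 => stepsB m + stepsD m + 2

/-- As `stepsA`, where the path enters from `v₁` on the second edge. -/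
def stepsB : ℕ → ℕ
  | 0 => 3
  | m + 1 => stepsC m + stepsD m + 2

/-- As `stepsA`, where the path enters from `v₁` on the third edge. -/
def stepsC : ℕ → ℕ
  | 0 => 3
  | m + 1 => stepsA m + 2

/-- As `stepsA`, while only the first edge joins the last `m` gadgets and the pac to the rest. -/
def stepsD : ℕ → ℕ
  | 0 => 1
  | m + 1 => stepsE m + 1

/-- As `stepsA`, while only the third edge joins the last `m` gadgets and the pac to the rest. -/
def stepsE : ℕ → ℕ
  | 0 => 1
  | m + 1 => stepsA m

end

theorem attach_of_eq {G : SimpleGraph ℕ} {v : ℕ} {P Q : List ℕ} (A : List ℕ) (b : ℕ) (B : List ℕ)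
    (e : ℕ) (hA : A ≠ []) (hb : G.Adj v b) (he : G.Adj v e) (hP : P = A ++ v :: b :: (B ++ [e]))
    (hQ : Q = A ++ v :: e :: (B.reverse ++ [b])) : Attach G v P Q :=
  ⟨A, b, B, e, hA, hb, he, hP, hQ⟩

/-- The excursions, by the edges through which the path enters and is joined to the outside. -/
structure Excursions (n m t : ℕ) : Prop where
  a : ∀ X M : List ℕ, X ≠ [] → Run (natGraph n) (t + 3 ≤ ·) (stepsA m) (t + 5) (t + 4)
    (X ++ travAB m t ++ (t + 1) :: (M ++ [t + 2]))
    (X ++ travAC m t ++ (t + 2) :: (M.reverse ++ [t + 1]))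
  b : ∀ X M : List ℕ, X ≠ [] → Run (natGraph n) (t + 3 ≤ ·) (stepsB m) (t + 5) (t + 3)
    (X ++ (travAB m t).reverse ++ t :: (M ++ [t + 2]))
    (X ++ travBC m t ++ (t + 2) :: (M.reverse ++ [t]))
  c : ∀ X M : List ℕ, X ≠ [] → Run (natGraph n) (t + 3 ≤ ·) (stepsC m) (t + 4) (t + 3)
    (X ++ (travAC m t).reverse ++ t :: (M ++ [t + 1]))
    (X ++ (travBC m t).reverse ++ (t + 1) :: (M.reverse ++ [t]))
  d : ∀ X : List ℕ, X ≠ [] → ∃ v w, t + 3 ≤ v ∧ t + 3 ≤ w ∧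
    Run (natGraph n) (t + 3 ≤ ·) (stepsD m) v w (X ++ travAB m t) (X ++ travAC m t)
  e : ∀ X : List ℕ, X ≠ [] → ∃ v w, t + 3 ≤ v ∧ t + 3 ≤ w ∧
    Run (natGraph n) (t + 3 ≤ ·) (stepsE m) v w
      (X ++ (travAC m t).reverse) (X ++ (travBC m t).reverse)

/-- The pac is a triangle. When three edges join it to the rest, the path end attaches to each of
its vertices once; when only one edge does, a single step swaps the last two vertices. -/
theorem excursions_zero (n t : ℕ) (ht : t = 2 * n) : Excursions n 0 t := by
  have adj : ∀ i j, i < 2 * n + 6 → j < 2 * n + 6 → i ≠ j → (j = i + 3 ∨ i = j + 3 ∨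
      (2 * n + 3 ≤ i ∧ 2 * n + 3 ≤ j)) → (natGraph n).Adj i j := by
    intro i j hi hj hij h
    rw [natGraph_adj]
    omega
  constructor
  · intro X M hX
    simp only [travAB, travAC, stepsA]
    refine .trans (k := 1) (l := 2) (w := t + 5) (v' := t + 3)
      (Q := X ++ [t + 3, t + 5, t + 2] ++ M.reverse ++ [t + 1, t + 4]) (.single
        (attach_of_eq (X ++ [t + 3]) (t + 4) ((t + 1) :: M) (t + 2) (by simp)
        (by apply adj <;> omega) (by apply adj <;> omega) (by simp) (by simp))) ?_ (by omega)
        (by simp [List.getLast?_append, List.getLast?_cons])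
    refine .trans (k := 1) (l := 1) (w := t + 3) (v' := t + 4)
      (Q := X ++ [t + 3, t + 4, t + 1] ++ M ++ [t + 2, t + 5]) (.single
        (attach_of_eq X (t + 5) ((t + 2) :: M.reverse ++ [t + 1]) (t + 4) hX
        (by apply adj <;> omega) (by apply adj <;> omega) (by simp) (by simp))) (.single
        (attach_of_eq (X ++ [t + 3]) (t + 1) (M ++ [t + 2]) (t + 5) (by simp)
        (by apply adj <;> omega) (by apply adj <;> omega) (by simp) (by simp))) (by omega)
        (by simp [List.getLast?_append, List.getLast?_cons])
  · intro X M hX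
    simp only [travAB, travBC, stepsB]
    refine .trans (k := 1) (l := 2) (w := t + 5) (v' := t + 4)
      (Q := X ++ [t + 4, t + 5, t + 2] ++ M.reverse ++ [t, t + 3]) (.single
        (attach_of_eq (X ++ [t + 4]) (t + 3) (t :: M) (t + 2) (by simp)
        (by apply adj <;> omega) (by apply adj <;> omega) (by simp) (by simp))) ?_ (by omega)
        (by simp [List.getLast?_append, List.getLast?_cons])
    refine .trans (k := 1) (l := 1) (w := t + 4) (v' := t + 3)
      (Q := X ++ [t + 4, t + 3, t] ++ M ++ [t + 2, t + 5]) (.single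
        (attach_of_eq X (t + 5) ((t + 2) :: M.reverse ++ [t]) (t + 3) hX
        (by apply adj <;> omega) (by apply adj <;> omega) (by simp) (by simp))) (.single
        (attach_of_eq (X ++ [t + 4]) t (M ++ [t + 2]) (t + 5) (by simp)
        (by apply adj <;> omega) (by apply adj <;> omega) (by simp) (by simp))) (by omega)
        (by simp [List.getLast?_append, List.getLast?_cons])
  · intro X M hX
    simp only [travAC, travBC, stepsC]
    refine .trans (k := 1) (l := 2) (w := t + 4) (v' := t + 5)
      (Q := X ++ [t + 5, t + 4, t + 1] ++ M.reverse ++ [t, t + 3]) (.single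
        (attach_of_eq (X ++ [t + 5]) (t + 3) (t :: M) (t + 1) (by simp)
        (by apply adj <;> omega) (by apply adj <;> omega) (by simp) (by simp))) ?_ (by omega)
        (by simp [List.getLast?_append, List.getLast?_cons])
    refine .trans (k := 1) (l := 1) (w := t + 5) (v' := t + 3)
      (Q := X ++ [t + 5, t + 3, t] ++ M ++ [t + 1, t + 4]) (.single
        (attach_of_eq X (t + 4) ((t + 1) :: M.reverse ++ [t]) (t + 3) hX
        (by apply adj <;> omega) (by apply adj <;> omega) (by simp) (by simp))) (.single
        (attach_of_eq (X ++ [t + 5]) t (M ++ [t + 1]) (t + 4) (by simp)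
        (by apply adj <;> omega) (by apply adj <;> omega) (by simp) (by simp))) (by omega)
        (by simp [List.getLast?_append, List.getLast?_cons])
  · intro X hX
    refine ⟨t + 3, t + 3, le_rfl, le_rfl, .single
      (attach_of_eq X (t + 5) [] (t + 4) hX (by apply adj <;> omega) (by apply adj <;> omega)
      (by simp [travAB]) (by simp [travAC]))⟩
  · intro X hX
    refine ⟨t + 5, t + 5, by omega, by omega, .single
      (attach_of_eq X (t + 4) [] (t + 3) hX (by apply adj <;> omega) (by apply adj <;> omega)
      (by simp [travAC]) (by simp [travBC]))⟩

/-- Behind the gadget `{t + 3, t + 4}` the tail starts with `t + 5`, `t + 6`, `t + 7`, which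
continue the third, first and second strand. This cyclic shift turns each type of excursion into
others one level deeper. -/
theorem excursions_succ {n m t : ℕ} (ht : t + 2 * (m + 1) = 2 * n)
    (ih : Excursions n m (t + 2)) : Excursions n (m + 1) t := by
  have strand : ∀ i j, i ≤ t + 7 → j = i + 3 ∨ i = j + 3 → j ≤ t + 7 → (natGraph n).Adj i j := by
    intro i j hi hij hj
    rw [natGraph_adj]
    omega
  have gadget : (natGraph n).Adj (t + 3) (t + 4) := by
    rw [natGraph_adj]
    omega
  have mono : ∀ x, t + 2 + 3 ≤ x → t + 3 ≤ x := fun x hx => by omega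
  obtain ⟨⟨LAB, hAB⟩, ⟨LAC, hAC⟩, ⟨LBC, hBC⟩⟩ := trav_ends m (t + 2)
  constructor
  · intro X M hX
    obtain ⟨v, w, hv, hw, hd⟩ := ih.d (X ++ [t + 3, t + 4, t + 1] ++ M ++ [t + 2]) (by simp)
    -- Type `a` is composed of `b` backwards, a step along the gadget edge that puts the inner tail
    -- at the end of the path, an excursion `d` there, and a step out of the inner tail.
    have hb := (ih.b (X ++ [t + 3]) (M.reverse ++ [t + 1]) (by simp)).symm
    rw [stepsA, show stepsB m + stepsD m + 2 = stepsB m + (1 + (stepsD m + 1)) by ring]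
    refine .trans (w := t + 7) (v' := t + 3)
      (Q := X ++ [t + 3] ++ (travAB m (t + 2)).reverse ++ (t + 2) :: (M.reverse ++ [t + 1, t + 4]))
      (by simpa [travAB] using hb.mono mono) ?_ (by omega)
      (by simp [List.getLast?_append, List.getLast?_cons])
    refine .trans (Q := X ++ [t + 3, t + 4, t + 1] ++ M ++ [t + 2] ++ travAB m (t + 2))
      (.single (attach_of_eq X (t + 6) (LAB.reverse ++ (t + 5) :: (t + 2) :: (M.reverse ++ [t + 1]))
        (t + 4) hX (strand _ _ (by omega) (by omega) (by omega)) gadget (by simp [hAB])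
        (by simp [hAB]))) ?_ (show t + 3 ≠ v by omega)
      (by simp [hAB, List.getLast?_append, List.getLast?_cons])
    refine .trans (v' := t + 4) (hd.mono mono) (.single (attach_of_eq (X ++ [t + 3]) (t + 1)
      (M ++ (t + 2) :: (t + 5) :: LAC) (t + 7) (by simp) (strand _ _ (by omega) (by omega)
      (by omega)) (strand _ _ (by omega) (by omega) (by omega)) (by simp [hAC])
      (by simp [hAC, travAC]))) (by omega)
      (by simp [hAC, List.getLast?_append, List.getLast?_cons])
  · intro X M hX
    obtain ⟨v, w, hv, hw, hd⟩ := ih.d (X ++ [t + 4, t + 3, t] ++ M ++ [t + 2]) (by simp)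
    -- The same pattern as for `a`, with `c` in place of `b`; here `d` is used backwards.
    have hc := (ih.c (X ++ [t + 4]) (M.reverse ++ [t]) (by simp)).symm
    rw [stepsB, show stepsC m + stepsD m + 2 = stepsC m + (1 + (stepsD m + 1)) by ring]
    refine .trans (w := t + 6) (v' := t + 4)
      (Q := X ++ [t + 4] ++ (travAC m (t + 2)).reverse ++ (t + 2) :: (M.reverse ++ [t, t + 3]))
      (by simpa [travAB] using hc.mono mono) ?_ (by omega)
      (by simp [List.getLast?_append, List.getLast?_cons])
    refine .trans (Q := X ++ [t + 4, t + 3, t] ++ M ++ [t + 2] ++ travAC m (t + 2))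
      (.single (attach_of_eq X (t + 7) (LAC.reverse ++ (t + 5) :: (t + 2) :: (M.reverse ++ [t]))
        (t + 3) hX (strand _ _ (by omega) (by omega) (by omega)) gadget.symm (by simp [hAC])
        (by simp [hAC]))) ?_ (show t + 4 ≠ w by omega)
      (by simp [hAC, List.getLast?_append, List.getLast?_cons])
    refine .trans (v' := t + 3) (hd.symm.mono mono) (.single (attach_of_eq (X ++ [t + 4]) t
      (M ++ (t + 2) :: (t + 5) :: LAB) (t + 6) (by simp) (strand _ _ (by omega) (by omega)
      (by omega)) (strand _ _ (by omega) (by omega) (by omega)) (by simp [hAB])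
      (by simp [hAB, travBC]))) (by omega)
      (by simp [hAB, List.getLast?_append, List.getLast?_cons])
  · intro X M hX
    -- One step at each gadget vertex surrounds an inner `a` read backwards, for which the gadget
    -- belongs to the outside.
    have ha := (ih.a X (t :: (M ++ [t + 1])) hX).symm
    rw [stepsC, show stepsA m + 2 = 1 + (stepsA m + 1) by ring]
    refine .trans (Q := X ++ travAC m (t + 2) ++ [t + 4, t + 1] ++ M.reverse ++ [t, t + 3])
      (.single (attach_of_eq (X ++ travAC m (t + 2)) (t + 3) (t :: M) (t + 1) (by simp [hX])
        gadget.symm (strand _ _ (by omega) (by omega) (by omega)) (by simp [travAC]) (by simp)))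
      ?_ (show t + 4 ≠ t + 6 by omega) (by simp [List.getLast?_append, List.getLast?_cons])
    refine .trans (w := t + 7) (Q := X ++ travAB m (t + 2) ++ [t + 3, t] ++ M ++ [t + 1, t + 4])
      (by simpa using ha.mono mono) (.single (attach_of_eq (X ++ travAB m (t + 2)) t (M ++ [t + 1])
        (t + 4) (by simp [hX]) (strand _ _ (by omega) (by omega) (by omega)) gadget (by simp)
        (by simp [travBC]))) (by omega) (by simp [List.getLast?_append, List.getLast?_cons])
  · intro X hX
    obtain ⟨v, w, hv, hw, he⟩ := ih.e (X ++ [t + 3, t + 4]) (by simp)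
    refine ⟨t + 3, v, le_rfl, by omega, ?_⟩
    rw [stepsD, add_comm (stepsE m)]
    refine .trans (Q := X ++ [t + 3, t + 4] ++ (travBC m (t + 2)).reverse)
      (.single (attach_of_eq X (t + 6) (LBC ++ [t + 7]) (t + 4) hX
        (strand _ _ (by omega) (by omega) (by omega)) gadget (by simp [travAB, hBC])
        (by simp [hBC]))) (by simpa [travAC] using he.symm.mono mono) (by omega)
      (by simp [hBC, List.getLast?_cons])
  · intro X hX
    refine ⟨t + 6, t + 7, by omega, by omega, ?_⟩
    rw [stepsE]
    -- The gadget alone is the outer part of the path behind the inner tail, so `M` is empty and no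
    -- further step is needed.
    simpa [travAC, travBC] using ((ih.a X [] hX).symm).mono mono

theorem excursions {n m t : ℕ} (ht : t + 2 * m = 2 * n) : Excursions n m t := by
  induction m generalizing t with
  | zero => exact excursions_zero n t (by omega)
  | succ m ih => exact excursions_succ ht (ih (by omega))

-- Edge sets of the initial and the final cycle

section WalkEdges

variable {V : Type*}

/-- The edges between consecutive vertices of a list. -/
def walkEdges : List V → Set (Sym2 V)
  | [] => ∅
  | [_] => ∅
  | a :: b :: l => insert s(a, b) (walkEdges (b :: l))

theorem walkEdges_cons_cons (a b : V) (l : List V) :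
    walkEdges (a :: b :: l) = insert s(a, b) (walkEdges (b :: l)) := rfl

theorem walkEdges_append_cons (l : List V) (a b : V) (r : List V) :
    walkEdges (l ++ a :: b :: r) = insert s(a, b) (walkEdges (l ++ [a]) ∪ walkEdges (b :: r)) := by
  induction l with
  | nil => simp [walkEdges]
  | cons x l ih =>
    cases l with
    | nil => simp [walkEdges, Set.insert_comm]
    | cons y l =>
      simp only [List.cons_append, walkEdges_cons_cons] at ih ⊢
      rw [ih, Set.insert_comm, Set.insert_union]

theorem walkEdges_append_singleton (l : List V) (a b : V) :
    walkEdges (l ++ [a, b]) = insert s(a, b) (walkEdges (l ++ [a])) := by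
  simp [walkEdges_append_cons, walkEdges]

/-- This discards the reversals in the recursive definitions of the traversals. -/
theorem walkEdges_reverse (l : List V) : walkEdges l.reverse = walkEdges l := by
  induction l with
  | nil => rfl
  | cons a l ih =>
    cases l with
    | nil => rfl
    | cons b l =>
      have : (a :: b :: l).reverse = l.reverse ++ [b, a] := by simp
      rw [this, walkEdges_append_singleton, walkEdges_cons_cons, ← ih, Sym2.eq_swap]
      simp

theorem cycleEdges_cons (a : V) (l : List V) :
    cycleEdges (a :: l) = walkEdges (a :: (l ++ [a])) := by
  have key : ∀ (l : List V) (a c : V),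
      {e | ∃ q ∈ (a :: l).zip (l ++ [c]), e = s(q.1, q.2)} = walkEdges (a :: (l ++ [c])) := by
    intro l
    induction l with
    | nil => intro a c; ext e; simp [walkEdges]
    | cons b l ih =>
      intro a c
      rw [List.cons_append, walkEdges_cons_cons, ← ih]
      ext e
      simp
  rw [← key, cycleEdges]
  simp [List.rotate_cons_succ]

theorem cycleEdges_map {W : Type*} (f : V → W) (l : List V) :
    cycleEdges (l.map f) = Sym2.map f '' cycleEdges l := by
  ext e
  simp only [cycleEdges, ← List.map_rotate, List.zip_map, Set.mem_ofPred_eq, List.mem_map,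
    Set.mem_image]
  constructor
  · rintro ⟨_, ⟨q, hq, rfl⟩, rfl⟩
    exact ⟨_, ⟨q, hq, rfl⟩, rfl⟩
  · rintro ⟨_, ⟨q, hq, rfl⟩, rfl⟩
    exact ⟨_, ⟨q, hq, rfl⟩, rfl⟩

end WalkEdges

theorem trav_perm (m t : ℕ) :
    (travAB m t).Perm (List.range' (t + 3) (2 * m + 3)) ∧
      (travAC m t).Perm (List.range' (t + 3) (2 * m + 3)) ∧
      (travBC m t).Perm (List.range' (t + 3) (2 * m + 3)) := by
  induction m generalizing t with
  | zero =>
    simp only [travAB, travAC, travBC, List.range'_succ, List.range'_zero]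
    exact ⟨.cons _ (.swap _ _ _), .refl _, .swap _ _ _⟩
  | succ m ih =>
    obtain ⟨h₁, h₂, h₃⟩ := ih (t + 2)
    have h : List.range' (t + 3) (2 * (m + 1) + 3) =
        (t + 3) :: (t + 4) :: List.range' (t + 2 + 3) (2 * m + 3) := by
      rw [show 2 * (m + 1) + 3 = 2 * m + 3 + 1 + 1 by ring, List.range'_succ, List.range'_succ]
    rw [h, travAB, travAC, travBC]
    exact ⟨.cons _ ((List.perm_append_singleton _ _).trans (.cons _ h₃)),
      .cons _ (.cons _ ((List.reverse_perm _).trans h₂)),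
      (List.Perm.cons _ (.cons _ ((List.reverse_perm _).trans h₁))).trans (.swap _ _ _)⟩

theorem isChain_iff_walkEdges {V : Type*} (G : SimpleGraph V) (l : List V) :
    l.IsChain G.Adj ↔ walkEdges l ⊆ G.edgeSet := by
  induction l with
  | nil => simp [walkEdges]
  | cons a l ih =>
    cases l with
    | nil => simp [walkEdges]
    | cons b l => simp [walkEdges_cons_cons, Set.insert_subset_iff, ih]

theorem walkEdges_travAB (m t : ℕ) : walkEdges (travAB (m + 1) t) =
    insert s(t + 3, t + 6) (insert s(t + 4, t + 7) (walkEdges (travBC m (t + 2)))) := by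
  obtain ⟨L, hL⟩ := (trav_ends m (t + 2)).2.2
  have : travAB (m + 1) t = (t + 3) :: (t + 6) :: (L ++ [t + 7, t + 4]) := by simp [travAB, hL]
  rw [this, walkEdges_cons_cons, hL, ← List.cons_append, walkEdges_append_singleton,
    Sym2.eq_swap (a := t + 7)]
  rfl

theorem walkEdges_travAC (m t : ℕ) : walkEdges (travAC (m + 1) t) =
    insert s(t + 3, t + 4) (insert s(t + 4, t + 7) (walkEdges (travAC m (t + 2)))) := by
  obtain ⟨L, hL⟩ := (trav_ends m (t + 2)).2.1
  rw [← walkEdges_reverse (travAC m _)]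
  have : (travAC m (t + 2)).reverse = (t + 7) :: (L.reverse ++ [t + 5]) := by simp [hL]
  rw [travAC, this, walkEdges_cons_cons, walkEdges_cons_cons]

theorem walkEdges_travBC (m t : ℕ) : walkEdges (travBC (m + 1) t) =
    insert s(t + 3, t + 4) (insert s(t + 3, t + 6) (walkEdges (travAB m (t + 2)))) := by
  obtain ⟨L, hL⟩ := (trav_ends m (t + 2)).1
  rw [← walkEdges_reverse (travAB m _)]
  have : (travAB m (t + 2)).reverse = (t + 6) :: (L.reverse ++ [t + 5]) := by simp [hL]
  rw [travBC, this, walkEdges_cons_cons, walkEdges_cons_cons, Sym2.eq_swap (a := t + 4)]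

/-- The relation that defines `C₀ n`. -/
def rel₀ (n i j : ℕ) : Prop :=
  (i % 2 = 0 ∧ j = i + 3) ∨ (i % 2 = 1 ∧ j = i + 1) ∨ (i = 0 ∧ j = 1) ∨
    (i = 2 * n + 4 ∧ j = 2 * n + 5)

/-- The relation that defines `C₁ n`. -/
def rel₁ (n i j : ℕ) : Prop :=
  ((i % 2 = 1 ∨ i % 4 = 0) ∧ j = i + 3) ∨ (i % 4 = 1 ∧ j = i + 1) ∨ (i = 0 ∧ j = 2) ∨
    (i = 2 * n + 3 ∧ j = 2 * n + 5) ∨ (n % 2 = 0 ∧ i = 2 * n + 4 ∧ j = 2 * n + 5)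

/-- Each level adds the same two edges, `{t + 3, t + 4}` and `{t + 4, t + 7}`. As `t` is even,
parity alone describes them. -/
theorem mem_walkEdges_travAC {n m t : ℕ} (ht : t + 2 * m = 2 * n) (e : Sym2 ℕ) :
    e ∈ walkEdges (travAC m t) ↔
      ∃ i j, e = s(i, j) ∧ t + 3 ≤ i ∧ i < 2 * n + 6 ∧ j < 2 * n + 6 ∧ rel₀ n i j := by
  unfold rel₀
  induction m generalizing t with
  | zero =>
    simp only [travAC, walkEdges, Set.mem_insert_iff, Set.mem_empty_iff_false, or_false]
    constructor
    · rintro (rfl | rfl)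
      · exact ⟨_, _, rfl, by omega⟩
      · exact ⟨_, _, rfl, by omega⟩
    · rintro ⟨i, j, rfl, h⟩
      rcases Nat.eq_or_lt_of_le h.1 with rfl | h'
      · left; congr; omega
      · right; congr <;> omega
  | succ m ih =>
    rw [walkEdges_travAC, Set.mem_insert_iff, Set.mem_insert_iff, ih (by omega)]
    constructor
    · rintro (rfl | rfl | ⟨i, j, rfl, h⟩)
      · exact ⟨_, _, rfl, by omega⟩
      · exact ⟨_, _, rfl, by omega⟩
      · exact ⟨_, _, rfl, by omega⟩
    · rintro ⟨i, j, rfl, h⟩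
      rcases Nat.eq_or_lt_of_le h.1 with rfl | h'
      · left; congr; omega
      · rcases Nat.eq_or_lt_of_le h' with rfl | h'
        · right; left; congr; omega
        · exact .inr (.inr ⟨i, j, rfl, by omega⟩)

/-- `travAB` and `travBC` call each other while `t` grows by 2, so the pattern has period 4 and both
must be treated in one induction. Which of them reaches the pac depends on the parity of `n`. -/
theorem mem_walkEdges_travAB_travBC {n m t : ℕ} (ht : t + 2 * m = 2 * n) (e : Sym2 ℕ) :
    (t % 4 = 0 → (e ∈ walkEdges (travAB m t) ↔
      ∃ i j, e = s(i, j) ∧ t + 3 ≤ i ∧ i < 2 * n + 6 ∧ j < 2 * n + 6 ∧ rel₁ n i j)) ∧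
    (t % 4 = 2 → (e ∈ walkEdges (travBC m t) ↔
      ∃ i j, e = s(i, j) ∧ t + 3 ≤ i ∧ i < 2 * n + 6 ∧ j < 2 * n + 6 ∧ rel₁ n i j)) := by
  induction m generalizing t with
  | zero =>
    constructor
    · intro h4
      simp only [travAB, walkEdges, Set.mem_insert_iff, Set.mem_empty_iff_false, or_false]
      rw [Sym2.eq_swap (a := t + 5)]
      constructor
      · rintro (rfl | rfl)
        · exact ⟨_, _, rfl, by unfold rel₁; omega⟩
        · exact ⟨_, _, rfl, by unfold rel₁; omega⟩
      · rintro ⟨i, j, rfl, h⟩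
        unfold rel₁ at h
        rcases Nat.eq_or_lt_of_le h.1 with rfl | h'
        · left; congr; omega
        · right; congr <;> omega
    · intro h4
      simp only [travBC, walkEdges, Set.mem_insert_iff, Set.mem_empty_iff_false, or_false]
      rw [Sym2.eq_swap (a := t + 4)]
      constructor
      · rintro (rfl | rfl)
        · exact ⟨_, _, rfl, by unfold rel₁; omega⟩
        · exact ⟨_, _, rfl, by unfold rel₁; omega⟩
      · rintro ⟨i, j, rfl, h⟩
        unfold rel₁ at h
        rcases Nat.lt_or_ge j (i + 2) with h' | h'
        · left; congr <;> omega
        · right; congr <;> omega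
  | succ m ih =>
    constructor
    · intro h4
      rw [walkEdges_travAB, Set.mem_insert_iff, Set.mem_insert_iff, (ih (by omega)).2 (by omega)]
      constructor
      · rintro (rfl | rfl | ⟨i, j, rfl, h, h'⟩)
        · exact ⟨_, _, rfl, le_rfl, by omega, by omega, .inl ⟨.inl (by omega), rfl⟩⟩
        · exact ⟨_, _, rfl, by omega, by omega, by omega, .inl ⟨.inr (by omega), rfl⟩⟩
        · exact ⟨_, _, rfl, by omega, h'⟩
      · rintro ⟨i, j, rfl, h, h'⟩
        rcases Nat.lt_or_ge i (t + 5) with h5 | h5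
        · have hr := h'.2.2
          unfold rel₁ at hr
          have : (i = t + 3 ∧ j = t + 6) ∨ (i = t + 4 ∧ j = t + 7) := by omega
          rcases this with ⟨rfl, rfl⟩ | ⟨rfl, rfl⟩ <;> simp
        · exact .inr (.inr ⟨i, j, rfl, by omega, h'⟩)
    · intro h4
      rw [walkEdges_travBC, Set.mem_insert_iff, Set.mem_insert_iff, (ih (by omega)).1 (by omega)]
      constructor
      · rintro (rfl | rfl | ⟨i, j, rfl, h, h'⟩)
        · exact ⟨_, _, rfl, le_rfl, by omega, by omega, .inr (.inl ⟨by omega, rfl⟩)⟩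
        · exact ⟨_, _, rfl, by omega, by omega, by omega, .inl ⟨.inl (by omega), rfl⟩⟩
        · exact ⟨_, _, rfl, by omega, h'⟩
      · rintro ⟨i, j, rfl, h, h'⟩
        rcases Nat.lt_or_ge i (t + 5) with h5 | h5
        · have hr := h'.2.2
          unfold rel₁ at hr
          have : (i = t + 3 ∧ j = t + 4) ∨ (i = t + 3 ∧ j = t + 6) := by omega
          rcases this with ⟨rfl, rfl⟩ | ⟨rfl, rfl⟩ <;> simp
        · exact .inr (.inr ⟨i, j, rfl, by omega, h'⟩)

/-- The path that runs once around `C₀ n`. -/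
def startPath (n : ℕ) : List ℕ := [0] ++ travAC n 0 ++ [2, 1]

/-- The path at which the algorithm stops. -/
def finalPath (n : ℕ) : List ℕ := [0] ++ travAB n 0 ++ [1, 2]

theorem mem_cycleEdges_startPath (n : ℕ) (e : Sym2 ℕ) : e ∈ cycleEdges (startPath n) ↔
    ∃ i j, e = s(i, j) ∧ i < 2 * n + 6 ∧ j < 2 * n + 6 ∧ rel₀ n i j := by
  obtain ⟨L, hL⟩ := (trav_ends n 0).2.1
  have h : cycleEdges (startPath n) = insert s(0, 3) (insert s(2, 5) (insert s(1, 2)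
      (insert s(0, 1) (walkEdges (travAC n 0))))) := by
    have h₁ : startPath n = 0 :: (0 + 3) :: (L ++ [5, 2, 1]) := by simp [startPath, hL]
    rw [h₁, cycleEdges_cons, List.cons_append, walkEdges_cons_cons, hL]
    have h₂ : (0 + 3) :: (L ++ [5, 2, 1] ++ [0]) = ((0 + 3) :: L) ++ 5 :: 2 :: [1, 0] := by simp
    rw [h₂, walkEdges_append_cons]
    ext e
    simp [walkEdges, Sym2.eq_swap (a := 5) (b := 2), Sym2.eq_swap (a := 2) (b := 1),
      Sym2.eq_swap (a := 1) (b := 0)]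
  rw [h]
  simp only [Set.mem_insert_iff, mem_walkEdges_travAC (show 0 + 2 * n = 2 * n by omega), rel₀]
  constructor
  · rintro (rfl | rfl | rfl | rfl | ⟨i, j, rfl, h⟩)
    · exact ⟨_, _, rfl, by omega⟩
    · exact ⟨_, _, rfl, by omega⟩
    · exact ⟨_, _, rfl, by omega⟩
    · exact ⟨_, _, rfl, by omega⟩
    · exact ⟨_, _, rfl, by omega⟩
  · rintro ⟨i, j, rfl, h⟩
    by_cases h3 : 0 + 3 ≤ i
    · exact .inr (.inr (.inr (.inr ⟨i, j, rfl, by omega⟩)))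
    · have : (i = 0 ∧ j = 3) ∨ (i = 2 ∧ j = 5) ∨ (i = 1 ∧ j = 2) ∨ (i = 0 ∧ j = 1) := by omega
      rcases this with ⟨rfl, rfl⟩ | ⟨rfl, rfl⟩ | ⟨rfl, rfl⟩ | ⟨rfl, rfl⟩ <;> simp

theorem mem_cycleEdges_finalPath (n : ℕ) (e : Sym2 ℕ) : e ∈ cycleEdges (finalPath n) ↔
    ∃ i j, e = s(i, j) ∧ i < 2 * n + 6 ∧ j < 2 * n + 6 ∧ rel₁ n i j := by
  obtain ⟨L, hL⟩ := (trav_ends n 0).1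
  have h : cycleEdges (finalPath n) = insert s(0, 3) (insert s(1, 4) (insert s(1, 2)
      (insert s(0, 2) (walkEdges (travAB n 0))))) := by
    have h₁ : finalPath n = 0 :: (0 + 3) :: (L ++ [4, 1, 2]) := by simp [finalPath, hL]
    rw [h₁, cycleEdges_cons, List.cons_append, walkEdges_cons_cons, hL]
    have h₂ : (0 + 3) :: (L ++ [4, 1, 2] ++ [0]) = ((0 + 3) :: L) ++ 4 :: 1 :: [2, 0] := by simp
    rw [h₂, walkEdges_append_cons]
    ext e
    simp [walkEdges, Sym2.eq_swap (a := 4) (b := 1), Sym2.eq_swap (a := 2) (b := 0)]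
  rw [h]
  simp only [Set.mem_insert_iff, (mem_walkEdges_travAB_travBC (show 0 + 2 * n = 2 * n by omega)
    e).1 rfl, rel₁]
  constructor
  · rintro (rfl | rfl | rfl | rfl | ⟨i, j, rfl, h⟩)
    · exact ⟨_, _, rfl, by omega⟩
    · exact ⟨_, _, rfl, by omega⟩
    · exact ⟨_, _, rfl, by omega⟩
    · exact ⟨_, _, rfl, by omega⟩
    · exact ⟨_, _, rfl, by omega⟩
  · rintro ⟨i, j, rfl, h⟩
    by_cases h3 : 0 + 3 ≤ i
    · exact .inr (.inr (.inr (.inr ⟨i, j, rfl, by omega⟩)))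
    · have : (i = 0 ∧ j = 3) ∨ (i = 1 ∧ j = 4) ∨ (i = 1 ∧ j = 2) ∨ (i = 0 ∧ j = 2) := by omega
      rcases this with ⟨rfl, rfl⟩ | ⟨rfl, rfl⟩ | ⟨rfl, rfl⟩ | ⟨rfl, rfl⟩ <;> simp

theorem startPath_perm (n : ℕ) : (startPath n).Perm (List.range (2 * n + 6)) := by
  rw [List.range_eq_range', show 2 * n + 6 = 2 * n + 3 + 1 + 1 + 1 by ring, List.range'_succ,
    List.range'_succ, List.range'_succ, startPath]
  refine .cons _ (List.perm_append_comm.trans ?_)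
  exact (List.Perm.append (.swap _ _ _) (trav_perm n 0).2.1)

/-- The edges of the path are among those of its closure, which are already known explicitly. -/
theorem startPath_isChain (n : ℕ) : (startPath n).IsChain (natGraph n).Adj := by
  rw [isChain_iff_walkEdges]
  intro e he
  have : e ∈ cycleEdges (startPath n) := by
    have h₁ : startPath n = 0 :: (travAC n 0 ++ [2, 1]) := by simp [startPath]
    rw [h₁] at he ⊢
    rw [cycleEdges_cons, show 0 :: (travAC n 0 ++ [2, 1] ++ [0]) =
      (0 :: (travAC n 0 ++ [2])) ++ [1, 0] by simp, walkEdges_append_singleton]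
    right
    simpa using he
  rw [mem_cycleEdges_startPath] at this
  obtain ⟨i, j, rfl, hi, hj, h⟩ := this
  rw [SimpleGraph.mem_edgeSet, natGraph_adj]
  unfold rel₀ at h
  omega

-- Regularity and 3-connectedness

theorem degree_eq_three_of_neighbors {V : Type*} [Fintype V] [DecidableEq V] {G : SimpleGraph V}
    [DecidableRel G.Adj] {v a b c : V} (hab : a ≠ b) (hac : a ≠ c) (hbc : b ≠ c)
    (h : ∀ w, G.Adj v w ↔ w = a ∨ w = b ∨ w = c) : G.degree v = 3 := by
  rw [← SimpleGraph.card_neighborFinset_eq_degree, Finset.card_eq_three]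
  refine ⟨a, b, c, hab, hac, hbc, ?_⟩
  ext w
  simp [h]

theorem isRegularOfDegree_G {n : ℕ} (hn : 1 ≤ n) : (G n).IsRegularOfDegree 3 := by
  have key : ∀ (v : Fin (2 * n + 6)) (a b c : ℕ), a < 2 * n + 6 → b < 2 * n + 6 → c < 2 * n + 6 →
      a ≠ b → a ≠ c → b ≠ c → (∀ w : Fin (2 * n + 6), (G n).Adj v w ↔
        w.val = a ∨ w.val = b ∨ w.val = c) → (G n).degree v = 3 := by
    intro v a b c ha hb hc hab hac hbc h
    refine degree_eq_three_of_neighbors (a := ⟨a, ha⟩) (b := ⟨b, hb⟩) (c := ⟨c, hc⟩) (by simpa)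
      (by simpa) (by simpa) fun w => ?_
    rw [h, Fin.ext_iff, Fin.ext_iff, Fin.ext_iff]
  intro v
  have hv := v.2
  by_cases h0 : v.val = 0
  · refine key v 1 2 3 (by omega) (by omega) (by omega) (by omega) (by omega) (by omega) fun w => ?_
    rw [G_adj]; omega
  by_cases h1 : v.val = 1
  · refine key v 0 2 4 (by omega) (by omega) (by omega) (by omega) (by omega) (by omega) fun w => ?_
    rw [G_adj]; omega
  by_cases h2 : v.val = 2
  · refine key v 0 1 5 (by omega) (by omega) (by omega) (by omega) (by omega) (by omega) fun w => ?_
    rw [G_adj]; omega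
  by_cases h3 : v.val = 2 * n + 3
  · refine key v (2 * n) (2 * n + 4) (2 * n + 5) (by omega) (by omega) (by omega) (by omega)
      (by omega) (by omega) fun w => ?_
    rw [G_adj]; have := w.2; omega
  by_cases h4 : v.val = 2 * n + 4
  · refine key v (2 * n + 1) (2 * n + 3) (2 * n + 5) (by omega) (by omega) (by omega) (by omega)
      (by omega) (by omega) fun w => ?_
    rw [G_adj]; have := w.2; omega
  by_cases h5 : v.val = 2 * n + 5
  · refine key v (2 * n + 2) (2 * n + 3) (2 * n + 4) (by omega) (by omega) (by omega) (by omega)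
      (by omega) (by omega) fun w => ?_
    rw [G_adj]; have := w.2; omega
  rcases Nat.mod_two_eq_zero_or_one v.val with he | ho
  · refine key v (v - 3) (v - 1) (v + 3) (by omega) (by omega) (by omega) (by omega)
      (by omega) (by omega) fun w => ?_
    rw [G_adj]; have := w.2; omega
  · refine key v (v - 3) (v + 1) (v + 3) (by omega) (by omega) (by omega) (by omega)
      (by omega) (by omega) fun w => ?_
    rw [G_adj]; have := w.2; omega

/-- A set of vertices outside `S` that is closed under adjacency outside `S` and contains the first
vertex of a strand that avoids `S` contains all vertices outside `S`. -/
theorem mem_of_strand_avoids {n : ℕ} (S : Finset (Fin (2 * n + 6))) (hS : S.card < 3)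
    (R : ℕ → Prop) (r : ℕ) (hr : r < 3) (hR : R r)
    (hSr : ∀ v ∈ S, v.val % 3 ≠ r)
    (hclosed : ∀ u v : Fin (2 * n + 6), u ∉ S → v ∉ S → (G n).Adj u v → R u → R v)
    (v : Fin (2 * n + 6)) (hv : v ∉ S) : R v := by
  have strand : ∀ i (hi : i < 2 * n + 6), i % 3 = r → R i := by
    intro i
    induction i using Nat.strong_induction_on with
    | _ i ih =>
      intro hi hir
      rcases Nat.lt_or_ge i 3 with h | h
      · rwa [show i = r by omega]
      · refine hclosed ⟨i - 3, by omega⟩ ⟨i, hi⟩ (fun h' => hSr _ h' ?_) (fun h' => hSr _ h' hir) ?_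
          (ih (i - 3) (by omega) (by omega) (by omega))
        · simp only; omega
        · rw [G_adj]; dsimp only; omega
  have avoid : ∀ i (hi : i < 2 * n + 6), i % 3 = r → (⟨i, hi⟩ : Fin (2 * n + 6)) ∉ S :=
    fun i hi hir h => hSr _ h hir
  -- If no deleted vertex lies at or below `i` on its strand, the strand leads from `i` to the cap,
  -- and there to the intact strand `r`. The claim `up` is the counterpart at the pac.
  have down : ∀ i (hi : i < 2 * n + 6),
      (∀ j ∈ S, j.val % 3 = i % 3 → i < j.val) → R i := by
    intro i
    induction i using Nat.strong_induction_on with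
    | _ i ih =>
      intro hi hj
      have hiS : (⟨i, hi⟩ : Fin (2 * n + 6)) ∉ S := fun h => lt_irrefl _ (hj _ h rfl)
      rcases Nat.lt_or_ge i 3 with h | h
      · rcases eq_or_ne i r with rfl | hne
        · exact hR
        · refine hclosed ⟨r, by omega⟩ ⟨i, hi⟩ (avoid _ _ (by omega)) hiS ?_ hR
          rw [G_adj]; dsimp only; omega
      · have hj' : ∀ j ∈ S, j.val % 3 = (i - 3) % 3 → i - 3 < j.val := fun j hjS hj3 => by
          have := hj j hjS (by omega)
          omega
        refine hclosed ⟨i - 3, by omega⟩ ⟨i, hi⟩ (fun h' => lt_irrefl _ (hj' _ h' rfl)) hiS ?_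
          (ih (i - 3) (by omega) (by omega) hj')
        rw [G_adj]; dsimp only; omega
  have up : ∀ k i (hi : i < 2 * n + 6), i + k = 2 * n + 5 →
      (∀ j ∈ S, j.val % 3 = i % 3 → j.val < i) → R i := by
    intro k
    induction k using Nat.strong_induction_on with
    | _ k ih =>
      intro i hi hik hj
      have hiS : (⟨i, hi⟩ : Fin (2 * n + 6)) ∉ S := fun h => lt_irrefl _ (hj _ h rfl)
      rcases Nat.lt_or_ge k 3 with h | h
      · by_cases hir : i % 3 = r
        · exact strand i hi hir
        · obtain ⟨l, hl, hl', hlr⟩ : ∃ l, 2 * n + 3 ≤ l ∧ l < 2 * n + 6 ∧ l % 3 = r :=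
            -- This is the pac vertex on strand `r`, because `3 * (2 * n + 3)` vanishes modulo 3.
            ⟨2 * n + 3 + (r + 2 * (2 * n + 3)) % 3, by omega, by omega, by omega⟩
          refine hclosed ⟨l, hl'⟩ ⟨i, hi⟩ (avoid _ _ hlr) hiS ?_ (strand l hl' hlr)
          rw [G_adj]; dsimp only
          have : l ≠ i := by rintro rfl; exact hir hlr
          omega
      · have hj' : ∀ j ∈ S, j.val % 3 = (i + 3) % 3 → j.val < i + 3 := fun j hjS hj3 => by
          have := hj j hjS (by omega)
          omega
        refine hclosed ⟨i + 3, by omega⟩ ⟨i, hi⟩ (fun h' => lt_irrefl _ (hj' _ h' rfl)) hiS ?_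
          (ih (k - 3) (by omega) (i + 3) (by omega) (by omega) hj')
        rw [G_adj]; dsimp only; omega
  by_cases hd : ∀ j ∈ S, j.val % 3 = v.val % 3 → v.val < j.val
  · exact down v v.2 hd
  by_cases hu : ∀ j ∈ S, j.val % 3 = v.val % 3 → j.val < v.val
  · exact up (2 * n + 5 - v) v v.2 (by omega) hu
  -- Otherwise `v` lies between two deleted vertices of its own strand. These exhaust `S`, so the
  -- neighbour of `v` in its gadget lies on an intact strand.
  push Not at hd hu
  obtain ⟨x, hx, hxv, hxl⟩ := hd
  obtain ⟨y, hy, hyv, hyl⟩ := hu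
  have hvx : v.val ≠ x.val := fun h => hv (by rwa [Fin.ext h])
  have hvy : v.val ≠ y.val := fun h => hv (by rwa [Fin.ext h])
  have hxy : x ≠ y := by rintro rfl; omega
  have hSxy : ∀ j ∈ S, j.val % 3 = v.val % 3 := by
    intro j hj
    by_contra hne
    have hjx : j ≠ x := by rintro rfl; exact hne hxv
    have hjy : j ≠ y := by rintro rfl; exact hne hyv
    have : ({j, x, y} : Finset (Fin (2 * n + 6))).card ≤ S.card :=
      Finset.card_le_card (by simp [Finset.insert_subset_iff, hj, hx, hy])
    rw [Finset.card_eq_three.2 ⟨j, x, y, hjx, hjy, hxy, rfl⟩] at this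
    omega
  have hy2 := y.2
  obtain ⟨w, hw, hadj⟩ : ∃ w : Fin (2 * n + 6), w.val % 3 ≠ v.val % 3 ∧ (G n).Adj w v := by
    rcases Nat.mod_two_eq_zero_or_one v.val with he | ho
    · refine ⟨⟨v - 1, by omega⟩, by simp only; omega, ?_⟩
      rw [G_adj]; dsimp only; omega
    · refine ⟨⟨v + 1, by omega⟩, by simp only; omega, ?_⟩
      rw [G_adj]; dsimp only; omega
  exact hclosed w v (fun h => hw (hSxy _ h)) hv hadj
    (down w w.2 fun j hj hjw => absurd (hjw.symm.trans (hSxy j hj)) hw)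

/-- By pigeonhole, fewer than three deleted vertices miss one residue class modulo 3; its first
vertex serves as the base point. -/
theorem isThreeConnected_G (n : ℕ) : IsThreeConnected (G n) := by
  refine ⟨by simp, fun S hS => ?_⟩
  obtain ⟨r, hr, hSr⟩ : ∃ r < 3, ∀ v ∈ S, v.val % 3 ≠ r := by
    by_contra! h
    have : (Finset.range 3) ⊆ S.image fun v => v.val % 3 := by
      intro r hr
      obtain ⟨v, hv, hvr⟩ := h r (Finset.mem_range.1 hr)
      exact Finset.mem_image.2 ⟨v, hv, hvr⟩
    have := (Finset.card_le_card this).trans Finset.card_image_le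
    simp at this
    omega
  have hr' : r < 2 * n + 6 := by omega
  have hrS : (⟨r, hr'⟩ : Fin (2 * n + 6)) ∉ S := fun h => hSr _ h (by simp only; omega)
  rw [SimpleGraph.connected_iff_exists_forall_reachable]
  refine ⟨⟨⟨r, hr'⟩, by simpa using hrS⟩, ?_⟩
  rintro ⟨v, hv⟩
  have hv' : v ∉ S := by simpa using hv
  have hreach := mem_of_strand_avoids S hS
    (fun i => ∃ (hi : i < 2 * n + 6)
      (h : (⟨i, hi⟩ : Fin (2 * n + 6)) ∈ ((S : Set (Fin (2 * n + 6)))ᶜ)),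
      ((G n).induce ((S : Set (Fin (2 * n + 6)))ᶜ)).Reachable ⟨⟨r, hr'⟩, by simpa using hrS⟩
        ⟨⟨i, hi⟩, h⟩) r hr ⟨hr', by simpa using hrS, .refl _⟩ hSr
    (by
      rintro u w hu hw huw ⟨hi, h, hreach⟩
      refine ⟨w.2, by simpa using hw, hreach.trans (SimpleGraph.Adj.reachable ?_)⟩
      simpa using huw) v hv'
  exact hreach.2.2

-- Planarity: a straight-line drawing on three rays

/-- Three directions that divide the plane into three sectors. -/
noncomputable def direction (r : ℕ) : ℝ × ℝ :=
  if r = 0 then (1, 0) else if r = 1 then (0, 1) else (-1, -1)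

/-- The nonnegative coordinates of a point with respect to the three directions, one of which
vanishes. -/
noncomputable def coordinate (x : ℝ × ℝ) (r : ℕ) : ℝ :=
  (if r = 0 then x.1 else if r = 1 then x.2 else 0) - min 0 (min x.1 x.2)

/-- The three directions sum to zero, so coordinates are determined up to a common shift. A
combination of at most two directions leaves one coordinate zero and the others nonnegative, which
is the normalization in `coordinate`. -/
theorem coordinate_direction {r s k : ℕ} (hr : r < 3) (hs : s < 3) (hk : k < 3) {a b : ℝ}
    (ha : 0 ≤ a) (hb : 0 ≤ b) : coordinate (a • direction r + b • direction s) k =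
      (if k = r then a else 0) + (if k = s then b else 0) := by
  have h₁ : -a + -b ≤ 0 := by linarith
  have h₂ : a + -b ≥ -b := by linarith
  have h₃ : -a + b ≥ -a := by linarith
  interval_cases r <;> interval_cases s <;> interval_cases k <;>
    simp [coordinate, direction, ha, hb] <;>
    first
    | linarith
    | (rw [min_def]; split_ifs <;> linarith)

theorem coordinate_smul {r k : ℕ} (hr : r < 3) (hk : k < 3) {a : ℝ} (ha : 0 ≤ a) :
    coordinate (a • direction r) k = if k = r then a else 0 := by
  simpa using coordinate_direction hr hr hk ha le_rfl

theorem smul_direction_inj {r s : ℕ} (hr : r < 3) (hs : s < 3) {a b : ℝ} (ha : 0 < a) (hb : 0 < b)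
    (h : a • direction r = b • direction s) : r = s ∧ a = b := by
  have h' := congrArg (coordinate · r) h
  simp only [coordinate_smul hr hr ha.le, coordinate_smul hs hr hb.le] at h'
  by_cases hrs : r = s
  · exact ⟨hrs, by simpa [hrs] using h'⟩
  · simp [hrs, ha.ne'] at h'

/-- A point of the segment between two rays that lies on a ray is an end of the segment. -/
theorem eq_of_smul_direction_eq {r s t : ℕ} (hr : r < 3) (hs : s < 3) (ht : t < 3) (hst : s ≠ t)
    {h a b : ℝ} (hh : 0 < h) (ha : 0 ≤ a) (hb : 0 ≤ b)
    (heq : h • direction r = a • direction s + b • direction t) :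
    (r = s ∨ r = t) ∧ h = a + b := by
  have key : ∀ k < 3, (if k = r then h else 0) = (if k = s then a else 0) +
      (if k = t then b else 0) := fun k hk => by
    rw [← coordinate_direction hs ht hk ha hb, ← heq, coordinate_smul hr hk hh.le]
  have h₁ := key r hr
  have h₂ := key s hs
  have h₃ := key t ht
  by_cases hrs : r = s
  · subst hrs
    simp [hst, hst.symm] at h₁ h₃
    exact ⟨.inl rfl, by linarith⟩
  · by_cases hrt : r = t
    · subst hrt
      simp [hst, hst.symm] at h₁ h₂
      exact ⟨.inr rfl, by linarith⟩
    · simp [hrs, hrt] at h₁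
      exact absurd h₁ hh.ne'

/-- A common point of two segments at the same level between different pairs of rays is a common
end of these segments. -/
theorem exists_smul_direction_of_eq {s t s' t' : ℕ} (hs : s < 3) (ht : t < 3) (hs' : s' < 3)
    (ht' : t' < 3) (hst : s ≠ t) (hst' : s' ≠ t') {a b a' b' : ℝ} (ha : 0 ≤ a) (hb : 0 ≤ b)
    (ha' : 0 ≤ a') (hb' : 0 ≤ b') (hab : 0 < a + b)
    (heq : a • direction s + b • direction t = a' • direction s' + b' • direction t') :
    a + b = a' + b' ∧ ((s(s, t) = s(s', t')) ∨ ∃ r, (r = s ∨ r = t) ∧ (r = s' ∨ r = t') ∧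
      a • direction s + b • direction t = (a + b) • direction r) := by
  rcases ha.eq_or_lt with rfl | ha
  · simp only [zero_smul, zero_add] at hab heq ⊢
    obtain ⟨h₁, h₂⟩ := eq_of_smul_direction_eq ht hs' ht' hst' hab ha' hb' heq
    exact ⟨h₂, .inr ⟨t, .inr rfl, h₁, rfl⟩⟩
  rcases hb.eq_or_lt with rfl | hb
  · simp only [zero_smul, add_zero] at hab heq ⊢
    obtain ⟨h₁, h₂⟩ := eq_of_smul_direction_eq hs hs' ht' hst' hab ha' hb' heq
    exact ⟨h₂, .inr ⟨s, .inl rfl, h₁, rfl⟩⟩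
  have key : ∀ k < 3, (if k = s then a else 0) + (if k = t then b else 0) =
      (if k = s' then a' else 0) + (if k = t' then b' else 0) := fun k hk => by
    rw [← coordinate_direction hs' ht' hk ha' hb', ← heq, coordinate_direction hs ht hk ha.le hb.le]
  have h₁ := key s hs
  have h₂ := key t ht
  have h₃ : s = s' ∨ s = t' := by
    by_contra! h
    simp [hst, h.1, h.2, ha.ne'] at h₁
  have h₄ : t = s' ∨ t = t' := by
    by_contra! h
    simp [hst.symm, h.1, h.2, hb.ne'] at h₂
  rcases h₃ with rfl | rfl <;> rcases h₄ with rfl | rfl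
  · exact absurd rfl hst
  · simp [hst, hst.symm] at h₁ h₂
    exact ⟨by rw [h₁, h₂], .inl rfl⟩
  · simp [hst, hst.symm] at h₁ h₂
    exact ⟨by rw [h₁, h₂, add_comm], .inl Sym2.eq_swap⟩
  · exact absurd rfl hst

/-- The distance from the centre, in the drawing, of the vertex `i`. -/
def level (n i : ℕ) : ℕ := if i < 3 then 1 else if i < 2 * n + 5 then (i + 1) / 2 else n + 2

theorem level_pos (n i : ℕ) : 0 < level n i := by
  unfold level
  split_ifs <;> omega

theorem level_lt_level {n i j : ℕ} (hj : j < 2 * n + 6) (hij : i < j) (h : i % 3 = j % 3) :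
    level n i < level n j := by
  unfold level
  split_ifs <;> omega

theorem eq_of_level_eq {n i j : ℕ} (hi : i < 2 * n + 6) (hj : j < 2 * n + 6) (h : i % 3 = j % 3)
    (hl : level n i = level n j) : i = j := by
  rcases lt_trichotomy i j with h' | h' | h'
  · exact absurd hl (level_lt_level hj h' h).ne
  · exact h'
  · exact absurd hl (level_lt_level hi h' h.symm).ne'

/-- The position of the vertex `i` in the drawing. -/
noncomputable def position (n i : ℕ) : ℝ × ℝ := (level n i : ℝ) • direction (i % 3)

theorem position_inj {n i j : ℕ} (hi : i < 2 * n + 6) (hj : j < 2 * n + 6)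
    (h : position n i = position n j) : i = j := by
  obtain ⟨h₁, h₂⟩ := smul_direction_inj (Nat.mod_lt _ (by omega)) (Nat.mod_lt _ (by omega))
    (Nat.cast_pos.2 (level_pos n i)) (Nat.cast_pos.2 (level_pos n j)) h
  exact eq_of_level_eq hi hj h₁ (Nat.cast_injective h₂)

/-- This dichotomy organizes the drawing: an edge either runs along a ray or joins two rays at the
same level. -/
theorem strand_or_level {n : ℕ} {u v : Fin (2 * n + 6)} (h : (G n).Adj u v) :
    v.val = u.val + 3 ∨ u.val = v.val + 3 ∨
      (level n u = level n v ∧ u.val % 3 ≠ v.val % 3) := by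
  rw [G_adj] at h
  have := u.2
  have := v.2
  unfold level
  split_ifs <;> omega

theorem mem_segment_strand {n i : ℕ} (hi : i + 3 < 2 * n + 6) {x : ℝ × ℝ}
    (hx : x ∈ segment ℝ (position n i) (position n (i + 3))) :
    ∃ h : ℝ, level n i ≤ h ∧ h ≤ level n (i + 3) ∧ x = h • direction (i % 3) := by
  obtain ⟨a, b, ha, hb, hab, rfl⟩ := hx
  have hl : (level n i : ℝ) ≤ level n (i + 3) :=
    Nat.cast_le.2 (level_lt_level hi (by omega) (by omega)).le
  refine ⟨a * level n i + b * level n (i + 3), ?_, ?_, ?_⟩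
  · obtain rfl : a = 1 - b := by linarith
    nlinarith
  · obtain rfl : b = 1 - a := by linarith
    nlinarith
  · rw [position, position, Nat.add_mod_right, smul_smul, smul_smul, add_smul]

theorem mem_segment_level {n i j : ℕ} (hl : level n i = level n j) {x : ℝ × ℝ}
    (hx : x ∈ segment ℝ (position n i) (position n j)) :
    ∃ a b : ℝ, 0 ≤ a ∧ 0 ≤ b ∧ a + b = level n i ∧
      x = a • direction (i % 3) + b • direction (j % 3) := by
  obtain ⟨a, b, ha, hb, hab, rfl⟩ := hx
  refine ⟨a * level n i, b * level n i, by positivity, by positivity, ?_, ?_⟩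
  · rw [← add_mul, hab, one_mul]
  · rw [position, position, smul_smul, smul_smul, hl]

/-- The edge between the vertices `i` and `j`, in the drawing. -/
noncomputable def drawnEdge (n : ℕ) : Sym2 (Fin (2 * n + 6)) → Set (ℝ × ℝ) :=
  Sym2.lift ⟨fun u v => segment ℝ (position n u) (position n v), fun _ _ => segment_symm _ _ _⟩

/-- The ways in which a point can lie on a drawn edge. -/
theorem mem_drawnEdge {n : ℕ} {e : Sym2 (Fin (2 * n + 6))} (he : e ∈ (G n).edgeSet) {x : ℝ × ℝ}
    (hx : x ∈ drawnEdge n e) :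
    (∃ u v : Fin (2 * n + 6), e = s(u, v) ∧ v.val = u.val + 3 ∧
      ∃ h : ℝ, level n u ≤ h ∧ h ≤ level n v ∧ x = h • direction (u.val % 3)) ∨
    (∃ u v : Fin (2 * n + 6), e = s(u, v) ∧ level n u = level n v ∧ u.val % 3 ≠ v.val % 3 ∧
      ∃ a b : ℝ, 0 ≤ a ∧ 0 ≤ b ∧ a + b = level n u ∧
        x = a • direction (u.val % 3) + b • direction (v.val % 3)) := by
  induction e using Sym2.ind with
  | _ u v =>
    rw [SimpleGraph.mem_edgeSet] at he
    rcases strand_or_level he with h | h | ⟨h, h'⟩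
    · refine .inl ⟨u, v, rfl, h, ?_⟩
      have := v.2
      rw [h]
      refine mem_segment_strand (by omega) ?_
      rw [← h]
      exact hx
    · refine .inl ⟨v, u, Sym2.eq_swap, h, ?_⟩
      have := u.2
      rw [h]
      refine mem_segment_strand (by omega) ?_
      rw [← h, segment_symm]
      exact hx
    · exact .inr ⟨u, v, rfl, h, h', mem_segment_level h hx⟩

theorem drawn_vertex_mem {n : ℕ} {e : Sym2 (Fin (2 * n + 6))} (he : e ∈ (G n).edgeSet)
    {w : Fin (2 * n + 6)} (hw : position n w ∈ drawnEdge n e) : w ∈ e := by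
  have hpos : ∀ i, (0 : ℝ) < level n i := fun i => Nat.cast_pos.2 (level_pos n i)
  have h3 : ∀ i, i % 3 < 3 := fun i => Nat.mod_lt _ (by omega)
  have hw2 := w.2
  rcases mem_drawnEdge he hw with ⟨u, v, rfl, huv, h, h₁, h₂, hx⟩ |
    ⟨u, v, rfl, hl, hne, a, b, ha, hb, hab, hx⟩
  · obtain ⟨hr, rfl⟩ := smul_direction_inj (h3 _) (h3 _) (hpos _) ((hpos _).trans_le h₁) hx
    rw [Nat.cast_le] at h₁ h₂
    rcases lt_trichotomy w.val u.val with h | h | h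
    · exact absurd h₁ (level_lt_level u.2 h hr).not_ge
    · simp [Fin.ext h]
    · rcases lt_trichotomy w.val v.val with h' | h' | h'
      · omega
      · simp [Fin.ext h']
      · exact absurd h₂ (level_lt_level w.2 h' (by omega)).not_ge
  · obtain ⟨hr, h⟩ := eq_of_smul_direction_eq (h3 _) (h3 _) (h3 _) hne (hpos _) ha hb hx
    have h' : level n w = level n u := Nat.cast_injective (h.trans hab)
    rcases hr with hr | hr
    · simp [Fin.ext (eq_of_level_eq w.2 u.2 hr h')]
    · simp [Fin.ext (eq_of_level_eq w.2 v.2 hr (h'.trans hl))]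

/-- Strand edges on one ray occupy intervals of levels that overlap at most in an end. A segment
between two rays meets rays only in its ends. Two such segments at one level share at most an end,
unless they join the same rays and coincide. That the vertex found belongs to both edges follows
from `drawn_vertex_mem`. -/
theorem drawnEdge_inter {n : ℕ} {e f : Sym2 (Fin (2 * n + 6))} (he : e ∈ (G n).edgeSet)
    (hf : f ∈ (G n).edgeSet) (hef : e ≠ f) {x : ℝ × ℝ} (hxe : x ∈ drawnEdge n e)
    (hxf : x ∈ drawnEdge n f) : ∃ w : Fin (2 * n + 6), x = position n w := by
  have hpos : ∀ i, (0 : ℝ) < level n i := fun i => Nat.cast_pos.2 (level_pos n i)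
  have h3 : ∀ i, i % 3 < 3 := fun i => Nat.mod_lt _ (by omega)
  rcases mem_drawnEdge he hxe with ⟨u, v, rfl, huv, h, h₁, h₂, rfl⟩ |
    ⟨u, v, rfl, hl, hne, a, b, ha, hb, hab, rfl⟩ <;>
  rcases mem_drawnEdge hf hxf with ⟨u', v', rfl, huv', h', h₁', h₂', hx⟩ |
    ⟨u', v', rfl, hl', hne', a', b', ha', hb', hab', hx⟩
  · obtain ⟨hr, rfl⟩ := smul_direction_inj (h3 _) (h3 _) ((hpos _).trans_le h₁)
      ((hpos _).trans_le h₁') hx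
    rcases lt_trichotomy u.val u'.val with hu | hu | hu
    · have : level n v ≤ level n u' := by
        rcases eq_or_lt_of_le (show v.val ≤ u'.val by omega) with hv | hv
        · rw [hv]
        · exact (level_lt_level u'.2 hv (by omega)).le
      refine ⟨u', ?_⟩
      rw [position, ← hr, le_antisymm (h₂.trans (Nat.cast_le.2 this)) h₁']
    · exact absurd (by rw [Fin.ext hu, Fin.ext (show v.val = v'.val by omega)]) hef
    · have : level n v' ≤ level n u := by
        rcases eq_or_lt_of_le (show v'.val ≤ u.val by omega) with hv | hv
        · rw [hv]
        · exact (level_lt_level u.2 hv (by omega)).le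
      refine ⟨u, ?_⟩
      rw [position, le_antisymm (h₂'.trans (Nat.cast_le.2 this)) h₁]
  · obtain ⟨hr, h⟩ := eq_of_smul_direction_eq (h3 _) (h3 _) (h3 _) hne' ((hpos _).trans_le h₁) ha'
      hb' hx
    rw [hab'] at h
    rcases hr with hr | hr
    · exact ⟨u', by rw [position, ← hr, h]⟩
    · exact ⟨v', by rw [position, ← hr, h, hl']⟩
  · obtain ⟨hr, h⟩ := eq_of_smul_direction_eq (h3 _) (h3 _) (h3 _) hne ((hpos _).trans_le h₁') ha
      hb hx.symm
    rw [hab] at h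
    rw [hx]
    rcases hr with hr | hr
    · exact ⟨u, by rw [position, ← hr, h]⟩
    · exact ⟨v, by rw [position, ← hr, h, hl]⟩
  · obtain ⟨h, h' | ⟨r, hr, hr', h'⟩⟩ := exists_smul_direction_of_eq (h3 _) (h3 _) (h3 _) (h3 _)
      hne hne' ha hb ha' hb' (hab ▸ hpos _) hx
    · refine absurd ?_ hef
      rw [hab, hab'] at h
      have hlu : level n u = level n u' := Nat.cast_injective h
      rcases Sym2.eq_iff.1 h' with ⟨h₁, h₂⟩ | ⟨h₁, h₂⟩
      · rw [Fin.ext (eq_of_level_eq u.2 u'.2 h₁ hlu),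
          Fin.ext (eq_of_level_eq v.2 v'.2 h₂ (by omega))]
      · rw [Fin.ext (eq_of_level_eq u.2 v'.2 h₁ (by omega)),
          Fin.ext (eq_of_level_eq v.2 u'.2 h₂ (by omega)), Sym2.eq_swap]
    · rw [h', hab]
      rcases hr with rfl | rfl
      · exact ⟨u, rfl⟩
      · exact ⟨v, by rw [position, hl]⟩

theorem isPlanar_G (n : ℕ) : IsPlanar (G n) := by
  refine ⟨fun v => position n v, drawnEdge n, fun u v h => Fin.ext (position_inj u.2 v.2 h), ?_,
    fun e he w hw => drawn_vertex_mem he hw, ?_⟩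
  · intro u v huv
    have hne : position n u ≠ position n v :=
      fun h => huv.ne (Fin.ext (position_inj u.2 v.2 h))
    refine ⟨Path.segment _ _, ?_, Path.range_segment _ _⟩
    intro s t hst
    exact Subtype.ext (AffineMap.lineMap_injective ℝ hne hst)
  · rintro e he f hf hef x ⟨hxe, hxf⟩
    obtain ⟨w, rfl⟩ := drawnEdge_inter he hf hef hxe hxf
    exact ⟨w, ⟨drawn_vertex_mem he hxe, drawn_vertex_mem hf hxf⟩, rfl⟩

-- Determinism of the algorithm on cubic graphs

section Uniqueness

variable {V : Type*} {G : SimpleGraph V}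

theorem Attach.end_adj {v : V} {P Q : List V} (hP : IsHamPath G P) (h : Attach G v P Q) :
    ∃ L d e, P = L ++ [d, e] ∧ G.Adj e v ∧ G.Adj e d ∧ v ≠ d := by
  obtain ⟨A, b, B, e, hA, hb, he, rfl, rfl⟩ := h
  obtain ⟨B', d, hd⟩ : ∃ B' d, b :: B = B' ++ [d] := by
    rcases List.eq_nil_or_concat (b :: B) with h | ⟨L, d, h⟩
    · simp at h
    · exact ⟨L, d, by simpa using h⟩
  have heq : A ++ v :: b :: (B ++ [e]) = (A ++ v :: B') ++ [d, e] := by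
    rw [← List.cons_append, hd]; simp
  refine ⟨A ++ v :: B', d, e, heq, he.symm, ?_, ?_⟩
  · have hc := hP.2.2
    rw [heq, List.isChain_append] at hc
    have := hc.2.1
    simp at this
    exact this.symm
  · have hn := hP.1
    rw [heq] at hn
    rintro rfl
    simp [List.nodup_append, List.nodup_cons] at hn

/-- In a cubic graph, the end of a path can be attached to at most one vertex besides `w`, if `w` is
a neighbour of the end other than its predecessor. -/
theorem Attach.target_unique_of_ne [Fintype V] [DecidableRel G.Adj] (hG : G.IsRegularOfDegree 3)
    {v v' w d e : V} {P Q Q' L : List V} (hP : IsHamPath G P) (hPe : P = L ++ [d, e])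
    (hew : G.Adj e w) (hwd : w ≠ d) (h : Attach G v P Q) (h' : Attach G v' P Q') (hvw : v ≠ w)
    (hvw' : v' ≠ w) : Q = Q' := by
  classical
  suffices hvv : v = v' from (hvv ▸ h).target_unique hP.1 h'
  obtain ⟨L₁, d₁, e₁, hL₁, hev, hed, hvd⟩ := h.end_adj hP
  obtain ⟨L₂, d₂, e₂, hL₂, hev', -, hvd'⟩ := h'.end_adj hP
  have key : ∀ (M : List V) x y, P = M ++ [x, y] → x = d ∧ y = e := by
    intro M x y hM
    have := congrArg List.reverse (hPe.symm.trans hM)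
    simp at this
    exact ⟨this.2.1.symm, this.1.symm⟩
  obtain ⟨rfl, rfl⟩ := key _ _ _ hL₁
  obtain ⟨rfl, rfl⟩ := key _ _ _ hL₂
  by_contra hne
  -- Two different attaching vertices, together with the predecessor and `w`, would give the end
  -- four neighbours.
  have hcard : ({d₂, w, v, v'} : Finset V).card = 4 := by
    rw [Finset.card_insert_of_notMem, Finset.card_insert_of_notMem, Finset.card_pair hne]
    · simp [hvw.symm, hvw'.symm]
    · simp [hwd.symm, hvd.symm, hvd'.symm]
  have hle : ({d₂, w, v, v'} : Finset V).card ≤ (G.neighborFinset e₂).card :=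
    Finset.card_le_card (by simp [Finset.insert_subset_iff, hed, hew, hev, hev'])
  rw [SimpleGraph.card_neighborFinset_eq_degree, hG e₂] at hle
  omega

/-- For the first step, the excluded neighbour of the end is the first vertex of the path, to which
no lollipop attaches. -/
theorem Closes.target_unique [Fintype V] [DecidableRel G.Adj] (hG : G.IsRegularOfDegree 3)
    {P Q Q' : List V} (hc : Closes G P) (h : Lollipop G P Q) (h' : Lollipop G P Q') : Q = Q' := by
  have hP := h.1
  obtain ⟨v, h⟩ := h.exists_attach
  obtain ⟨v', h'⟩ := h'.exists_attach
  obtain ⟨a, M, b, rfl, hM, hba⟩ := hc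
  have hne : ∀ {v Q}, Attach G v (a :: (M ++ [b])) Q → v ≠ a := by
    rintro v Q ⟨A, b', B, e, hA, -, -, heq, -⟩ rfl
    obtain _ | ⟨x, A⟩ := A
    · exact hA rfl
    · have hn := hP.1
      rw [heq] at hn
      simp only [List.cons_append, List.cons.injEq] at heq hn
      simp [← heq.1] at hn
  rcases List.eq_nil_or_concat M with rfl | ⟨L, d, rfl⟩
  · exact absurd rfl hM
  refine Attach.target_unique_of_ne hG hP (L := a :: L) (d := d) (e := b) (by simp) hba ?_ h h'
    (hne h) (hne h')
  rintro rfl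
  simpa using hP.1

/-- For later steps, the excluded neighbour is the vertex of the previous attachment, since
attaching there again would restore `O`. -/
theorem Lollipop.target_unique [Fintype V] [DecidableRel G.Adj] (hG : G.IsRegularOfDegree 3)
    {O P Q Q' : List V} (h₀ : Lollipop G O P) (h : Lollipop G P Q) (h' : Lollipop G P Q')
    (hQ : Q ≠ O) (hQ' : Q' ≠ O) : Q = Q' := by
  have hP := h.1
  obtain ⟨w, h₀⟩ := h₀.exists_attach
  obtain ⟨v, h⟩ := h.exists_attach
  obtain ⟨v', h'⟩ := h'.exists_attach
  obtain ⟨L, d, e, hL, hew, -, hwd⟩ := h₀.symm.end_adj hP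
  refine Attach.target_unique_of_ne hG hP hL hew hwd h h' ?_ ?_
  · rintro rfl
    exact hQ (h.target_unique hP.1 h₀.symm)
  · rintro rfl
    exact hQ' (h'.target_unique hP.1 h₀.symm)

theorem mem_cycleEdges {P : List V} {e : Sym2 V} : e ∈ cycleEdges P ↔
    ∃ (i : ℕ) (h : i < P.length),
      e = s(P[i], P[(i + 1) % P.length]'(Nat.mod_lt _ (by omega))) := by
  simp only [cycleEdges, Set.mem_ofPred_eq, List.mem_iff_getElem, List.getElem_zip,
    List.getElem_rotate]
  constructor
  · rintro ⟨q, ⟨i, hi, rfl⟩, rfl⟩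
    simp only [List.length_zip, List.length_rotate, min_self] at hi
    exact ⟨i, hi, rfl⟩
  · rintro ⟨i, hi, rfl⟩
    exact ⟨_, ⟨i, by simpa using hi, rfl⟩, rfl⟩

/-- A cycle, its first vertex and its second vertex determine the order of its vertices. -/
theorem eq_of_cycleEdges_eq {L L' : List V} {a b : V} (hL : IsHamPath G L) (hL' : IsHamPath G L')
    (h : [a, b] <+: L) (h' : [a, b] <+: L') (hc : cycleEdges L = cycleEdges L') : L = L' := by
  have hlen : L.length = L'.length :=
    ((List.perm_ext_iff_of_nodup hL.1 hL'.1).2 fun v => by simp [hL.2.1, hL'.2.1]).length_eq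
  have key : ∀ k (hk : k < L.length), L[k] = L'[k]'(hlen ▸ hk) := by
    intro k
    induction k using Nat.strong_induction_on with
    | _ k ih =>
      intro hk
      obtain ⟨r, rfl⟩ := h
      obtain ⟨r', rfl⟩ := h'
      match k, ih, hk with
      | 0, _, _ => simp
      | 1, _, _ => simp
      | k + 2, ih, hk =>
        generalize [a, b] ++ r = L at *
        generalize [a, b] ++ r' = L' at *
        have hk0 := ih k (by omega) (by omega)
        have hk1 := ih (k + 1) (by omega) (by omega)
        have hmem : s(L'[k + 1]'(by omega), L'[k + 2]'(by omega)) ∈ cycleEdges L := by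
          rw [hc, mem_cycleEdges]
          refine ⟨k + 1, by omega, ?_⟩
          congr 2
          simp only [Nat.mod_eq_of_lt (show k + 1 + 1 < L'.length by omega)]
        obtain ⟨i, hi, he⟩ := mem_cycleEdges.1 hmem
        rcases Sym2.eq_iff.1 he with ⟨h₁, h₂⟩ | ⟨h₁, h₂⟩
        · rw [← hk1, hL.1.getElem_inj_iff] at h₁
          subst h₁
          rw [h₂]
          simp only [Nat.mod_eq_of_lt (show k + 1 + 1 < L.length by omega)]
        -- Here the edge would lead back to the preceding vertex, and `L'` would repeat it.
        · rw [← hk1, hL.1.getElem_inj_iff] at h₁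
          have hik : i = k := by
            rcases Nat.lt_or_ge (i + 1) L.length with h | h
            · rw [Nat.mod_eq_of_lt h] at h₁
              omega
            · rw [show i + 1 = L.length by omega, Nat.mod_self] at h₁
              omega
          subst hik
          rw [hk0, hL'.1.getElem_inj_iff] at h₂
          omega
  exact List.ext_getElem hlen fun k hk _ => key k hk

/-- Thomason's algorithm is deterministic on cubic graphs. -/
theorem IsRun.unique [Fintype V] [DecidableRel G.Adj] (hG : G.IsRegularOfDegree 3)
    {C : Set (Sym2 V)} {a b : V} {T T' : ℕ} {p p' : ℕ → List V} (h : IsRun G C a b T p)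
    (h' : IsRun G C a b T' p') : T' = T ∧ ∀ k ≤ T, p' k = p k := by
  have key : ∀ k, k ≤ T → k ≤ T' → p' k = p k := by
    intro k
    induction k using Nat.strong_induction_on with
    | _ k ih =>
      intro hk hk'
      match k with
      | 0 =>
        exact eq_of_cycleEdges_eq h'.start_path h.start_path h'.start_edge h.start_edge
          (h'.start_cycle.trans h.start_cycle.symm)
      | 1 =>
        have h₀ := ih 0 (by omega) (by omega) (by omega)
        exact Closes.target_unique hG h.start_closes (h₀ ▸ h'.step 0 (by omega))
          (h.step 0 (by omega))
      | k + 2 =>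
        have h₀ := ih k (by omega) (by omega) (by omega)
        have h₁ := ih (k + 1) (by omega) (by omega) (by omega)
        exact Lollipop.target_unique hG (h.step k (by omega)) (h₁ ▸ h'.step (k + 1) (by omega))
          (h.step (k + 1) (by omega)) (h₀ ▸ h'.no_return k (by omega)) (h.no_return k (by omega))
  have hT : T' = T := by
    rcases lt_trichotomy T' T with hlt | heq | hlt
    · exact absurd (key T' hlt.le le_rfl ▸ h'.finish) (h.running T' h'.pos hlt)
    · exact heq
    · exact absurd ((key T le_rfl hlt.le).symm ▸ h.finish) (h'.running T h.pos hlt)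
  exact ⟨hT, fun k hk => key k hk (hT ▸ hk)⟩

end Uniqueness

-- The run on `G n`

theorem adj_ofNat {n i j : ℕ} (h : (natGraph n).Adj i j) :
    (G n).Adj (Fin.ofNat (2 * n + 6) i) (Fin.ofNat (2 * n + 6) j) := by
  rw [natGraph, SimpleGraph.map_adj] at h
  obtain ⟨a, b, h, rfl, rfl⟩ := h
  simpa using h

theorem image_rel {n : ℕ} (r : ℕ → ℕ → Prop) (E : Set (Sym2 ℕ))
    (hE : ∀ e, e ∈ E ↔ ∃ i j, e = s(i, j) ∧ i < 2 * n + 6 ∧ j < 2 * n + 6 ∧ r i j) :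
    Sym2.map (Fin.ofNat (2 * n + 6)) '' E =
      {e | ∃ i j : Fin (2 * n + 6), e = s(i, j) ∧ r i.val j.val} := by
  ext e
  constructor
  · rintro ⟨e, he, rfl⟩
    obtain ⟨i, j, rfl, hi, hj, h⟩ := (hE e).1 he
    exact ⟨_, _, rfl, by simpa [Fin.ofNat, Nat.mod_eq_of_lt hi, Nat.mod_eq_of_lt hj] using h⟩
  · rintro ⟨i, j, rfl, h⟩
    exact ⟨s(i, j), (hE _).2 ⟨_, _, rfl, i.2, j.2, h⟩, by simp⟩

theorem startPath_isHamPath (n : ℕ) :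
    IsHamPath (G n) ((startPath n).map (Fin.ofNat (2 * n + 6))) := by
  refine ⟨?_, fun v => ?_, ?_⟩
  · refine List.Nodup.map_on ?_ ((startPath_perm n).nodup_iff.2 List.nodup_range)
    intro x hx y hy hxy
    rw [(startPath_perm n).mem_iff, List.mem_range] at hx hy
    simpa [Fin.ofNat, Fin.ext_iff, Nat.mod_eq_of_lt hx, Nat.mod_eq_of_lt hy] using hxy
  · refine List.mem_map.2 ⟨v, ?_, by simp⟩
    rw [(startPath_perm n).mem_iff]
    exact List.mem_range.2 v.2
  · rw [List.isChain_map]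
    exact (startPath_isChain n).imp fun _ _ => adj_ofNat

theorem exists_isRun (n : ℕ) : ∃ p : ℕ → List (Fin (2 * n + 6)),
    IsRun (G n) (C₀ n) (lam n) (greenEnd n) (stepsA n) p ∧
      cycleEdges (p (stepsA n)) = C₁ n := by
  -- With `t = 0` and `M = []`, the outside consists of the cap alone: the path starts at 0, and the
  -- vertices 1 and 2 follow the tail.
  have hrun := ((excursions (n := n) (m := n) (t := 0) (by omega)).a [0] [] (by simp)).symm
  obtain ⟨q, att, hq0, hqT, -, -, hT, hstep, hne, hend⟩ := hrun.exists_seq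
  replace hq0 : q 0 = startPath n := by simpa [startPath] using hq0
  replace hqT : q (stepsA n) = finalPath n := by simpa [finalPath] using hqT
  set f := Fin.ofNat (2 * n + 6) with hf
  have hstep' : ∀ i < stepsA n, Attach (G n) (f (att i)) ((q i).map f) ((q (i + 1)).map f) :=
    fun i hi => (hstep i hi).map f fun _ _ => adj_ofNat
  have hlt : ∀ i < stepsA n, att i < 2 * n + 6 := by
    intro i hi
    obtain ⟨_, _, _, _, _, h, _⟩ := hstep i hi
    exact (natGraph_adj.1 h).1
  have hlam : f 0 = lam n := rfl
  have hgreen : f 3 = greenEnd n := Fin.ext (Nat.mod_eq_of_lt (by omega))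
  have hham : ∀ i ≤ stepsA n, (q i).Perm (List.range (2 * n + 6)) ∧
      IsHamPath (G n) ((q i).map f) ∧ [lam n, greenEnd n] <+: (q i).map f := by
    intro i
    induction i with
    | zero =>
      intro _
      rw [hq0]
      refine ⟨startPath_perm n, startPath_isHamPath n, ?_⟩
      obtain ⟨L, hL⟩ := (trav_ends n 0).2.1
      simp [startPath, hL, ← hlam, ← hgreen, List.cons_prefix_cons]
    | succ i ih =>
      intro hi
      obtain ⟨h₁, h₂, h₃⟩ := ih (by omega)
      exact ⟨(hstep i hi).perm.symm.trans h₁, (hstep' i hi).isHamPath h₂, (hstep' i hi).prefix h₃⟩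
  have cap : ∀ i j, i < 3 → j < 3 → i ≠ j → (G n).Adj (f i) (f j) := by
    intro i j hi hj hij
    refine adj_ofNat (natGraph_adj.2 ?_)
    omega
  refine ⟨fun i => (q i).map f, ⟨(hham 0 (by omega)).2.1, (hham 0 (by omega)).2.2, ?_, ?_, hT,
    fun k hk => (hstep' k hk).lollipop (hham k hk.le).2.1, ?_, ?_, ?_⟩, ?_⟩
  · rw [hq0]
    exact ⟨f 0, (travAC n 0).map f ++ [f 2], f 1, by simp [startPath], by simp,
      cap 1 0 (by omega) (by omega) (by omega)⟩
  · rw [hq0, cycleEdges_map, image_rel (rel₀ n) _ (mem_cycleEdges_startPath n)]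
    rfl
  · intro k hk heq
    have h₁ := (hstep' k (by omega)).symm
    have h₂ := hstep' (k + 1) hk
    rw [show (q (k + 1 + 1)).map f = (q k).map f from heq] at h₂
    have := h₁.vertex_unique (hham (k + 1) hk.le).2.1.1 h₂
    have h₃ := hlt k (by omega)
    have h₄ := hlt (k + 1) hk
    refine hne k hk ?_
    simpa [hf, Fin.ofNat, Fin.ext_iff, Nat.mod_eq_of_lt h₃, Nat.mod_eq_of_lt h₄] using this
  · rintro k hk0 hk ⟨a, M, b, heq, hM, hba⟩
    obtain ⟨hperm, hP, hpre⟩ := hham k hk.le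
    have hlast : ((q k).map f).getLast? = some b := by
      simp [heq, List.getLast?_cons]
    rw [List.getLast?_map, Option.map_eq_some_iff] at hlast
    obtain ⟨x, hx, rfl⟩ := hlast
    have hx3 := hend k hk0 hk x hx
    have hxlt : x < 2 * n + 6 :=
      List.mem_range.1 (hperm.mem_iff.1 (List.mem_of_getLast? hx))
    rw [heq] at hpre hP
    obtain _ | ⟨c, M⟩ := M
    · exact hM rfl
    simp only [List.cons_append, List.cons_prefix_cons, List.nil_prefix, and_true] at hpre
    obtain ⟨rfl, rfl⟩ := hpre
    -- The end is at least 3, and the only such neighbour of 0 is 3. But 3 is always the second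
    -- vertex of the path, hence not its end.
    have hn : greenEnd n ≠ f x := by
      rintro h
      have := hP.1
      simp [h] at this
    rw [G_adj] at hba
    simp only [hf, Fin.ofNat, Nat.mod_eq_of_lt hxlt, lam, greenEnd, ne_eq, Fin.ext_iff] at hba hn
    omega
  · rw [hqT]
    exact ⟨f 0, (travAB n 0).map f ++ [f 1], f 2, by simp [finalPath], by simp,
      cap 2 0 (by omega) (by omega) (by omega)⟩
  · simp only
    rw [hqT, cycleEdges_map, image_rel (rel₁ n) _ (mem_cycleEdges_finalPath n)]
    rfl

-- The growth rate of the number of steps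

theorem stepsA_add_four (m : ℕ) : stepsA (m + 4) = 2 * stepsA (m + 1) + stepsA m + 8 := by
  rw [show m + 4 = m + 3 + 1 by ring, stepsA, show m + 3 = m + 2 + 1 by ring, stepsB, stepsD,
    show m + 2 = m + 1 + 1 by ring, stepsC, stepsE, stepsD, stepsE]
  ring

/-- The growth rate of the number of steps. -/
theorem exists_growth_rate : ∃ c : ℝ, 1.3953 < c ∧ c < 1.3954 ∧ c ^ 4 = 2 * c + 1 := by
  have hcont : ContinuousOn (fun x : ℝ => x ^ 4 - 2 * x - 1) (Set.Icc 1.3953 1.3954) := by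
    fun_prop
  obtain ⟨c, hc, h⟩ := intermediate_value_Ioo (by norm_num) hcont
    (show (0 : ℝ) ∈ Set.Ioo _ _ by constructor <;> norm_num)
  exact ⟨c, hc.1, hc.2, by linarith⟩

/-- A root of `z ^ 4 + 2 * z ^ 3 - 1` other than the positive root `r` is larger than `r` in
modulus. -/
theorem lt_norm_of_root {r : ℝ} (hr : 0 < r) (hroot : r ^ 4 + 2 * r ^ 3 - 1 = 0) {z : ℂ}
    (hz : z ^ 4 + 2 * z ^ 3 - 1 = 0) (hne : z ≠ (r : ℂ)) : r < ‖z‖ := by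
  by_contra! hle
  -- The equation reads `z ^ 3 * (z + 2) = 1`. If `‖z‖ ≤ r`, then `‖z + 2‖ ≥ r + 2`, which is
  -- equality in the triangle inequality and forces `z = r`.
  have hz3 : ‖z‖ ^ 3 * ‖z + 2‖ = 1 := by
    rw [← norm_pow, ← norm_mul, show z ^ 3 * (z + 2) = 1 by linear_combination hz, norm_one]
  have h₁ : ‖z‖ ^ 3 ≤ r ^ 3 := by gcongr
  have hr3 : r ^ 3 * (r + 2) = 1 := by linear_combination hroot
  have hsum : ‖z + 2‖ = r + 2 := by
    refine le_antisymm ((norm_add_le _ _).trans (by simpa using hle)) ?_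
    have : r ^ 3 * (r + 2) ≤ r ^ 3 * ‖z + 2‖ := by
      rw [hr3, ← hz3]
      gcongr
    exact le_of_mul_le_mul_left this (by positivity)
  have hre : z.re ≤ r := (Complex.re_le_norm z).trans hle
  have hsq : z.re ^ 2 + z.im ^ 2 ≤ r ^ 2 := by
    have := pow_le_pow_left₀ (norm_nonneg z) hle 2
    rw [Complex.sq_norm, Complex.normSq_apply] at this
    linarith
  have hsq2 : (z.re + 2) ^ 2 + z.im ^ 2 = (r + 2) ^ 2 := by
    have := congrArg (· ^ 2) hsum
    simp only [Complex.sq_norm, Complex.normSq_apply, Complex.add_re, Complex.add_im,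
      Complex.re_ofNat, Complex.im_ofNat] at this
    linarith
  have hre' : z.re = r := by linarith
  have him : z.im = 0 := by
    rw [hre'] at hsq2
    exact pow_eq_zero_iff two_ne_zero |>.1 (by linarith)
  exact hne (Complex.ext (by simpa using hre') (by simpa using him))

theorem stepsA_isTheta {c : ℝ} (hc : 1 < c) (hc4 : c ^ 4 = 2 * c + 1) :
    (fun n : ℕ => (stepsA n : ℝ)) =Θ[atTop] fun n : ℕ => c ^ n := by
  have hrec : ∀ m, (stepsA (m + 4) : ℝ) = 2 * stepsA (m + 1) + stepsA m + 8 := fun m => by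
    exact_mod_cast stepsA_add_four m
  have hpow : ∀ m, c ^ (m + 4) = 2 * c ^ (m + 1) + c ^ m := fun m => by
    rw [pow_add, hc4]; ring
  have hpos : ∀ m, 0 < c ^ m := fun m => pow_pos (by linarith) m
  have h0 : stepsA 0 = 3 := by rw [stepsA]
  have h1 : stepsA 1 = 6 := by rw [stepsA, stepsB, stepsD]
  have h2 : stepsA 2 = 10 := by rw [stepsA, stepsB, stepsD, stepsC, stepsD, stepsE]
  have h3 : stepsA 3 = 15 := by
    rw [stepsA, stepsB, stepsD, stepsC, stepsD, stepsE, stepsE, h0]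
  -- Adding 4 makes the recurrence homogeneous, since `8 + 4 = 2 * 4 + 4`. The factor 19 is `stepsA
  -- 3 + 4`, the largest initial value.
  have upper : ∀ m, (stepsA m : ℝ) + 4 ≤ 19 * c ^ m := by
    intro m
    induction m using Nat.strong_induction_on with
    | _ m ih =>
      have hone := one_le_pow₀ hc.le (n := m)
      match m with
      | 0 => norm_num [h0]
      | 1 => rw [h1]; push_cast; linarith
      | 2 => rw [h2]; push_cast; linarith
      | 3 => rw [h3]; push_cast; linarith
      | m + 4 =>
        have := ih m (by omega)
        have := ih (m + 1) (by omega)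
        rw [hrec, hpow]
        linarith
  -- The factor `c ^ 3` covers the four initial values; in the induction step the summand 8 is
  -- simply dropped.
  have lower : ∀ m, c ^ m ≤ c ^ 3 * stepsA m := by
    intro m
    have h3' := one_le_pow₀ hc.le (n := 3)
    have small : ∀ k ≤ 3, 1 ≤ stepsA k → c ^ k ≤ c ^ 3 * stepsA k := fun k hk hk1 => by
      have hk1' : (1 : ℝ) ≤ stepsA k := by exact_mod_cast hk1
      calc c ^ k ≤ c ^ 3 * 1 := by rw [mul_one]; exact pow_le_pow_right₀ hc.le hk
        _ ≤ _ := by gcongr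
    induction m using Nat.strong_induction_on with
    | _ m ih =>
      match m with
      | 0 => exact small 0 (by omega) (by omega)
      | 1 => exact small 1 (by omega) (by omega)
      | 2 => exact small 2 (by omega) (by omega)
      | 3 => exact small 3 (by omega) (by omega)
      | m + 4 =>
        have := ih m (by omega)
        have := ih (m + 1) (by omega)
        rw [hrec, hpow]
        nlinarith
  constructor
  · refine IsBigO.of_bound 19 (Eventually.of_forall fun m => ?_)
    rw [Real.norm_of_nonneg (by positivity), Real.norm_of_nonneg (hpos m).le]
    linarith [upper m]
  · refine IsBigO.of_bound (c ^ 3) (Eventually.of_forall fun m => ?_)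
    rw [Real.norm_of_nonneg (hpos m).le, Real.norm_of_nonneg (by positivity)]
    exact lower m

end Thomason

theorem theorem2 :
    (∀ n : ℕ, 3 ≤ n →
      (Thomason.G n).IsRegularOfDegree 3 ∧
      Thomason.IsThreeConnected (Thomason.G n) ∧
      Thomason.IsPlanar (Thomason.G n)) ∧
    ∃ (c : ℝ) (T : ℕ → ℕ),
      -- `1 / c` is the root of smallest modulus of `z ^ 4 + 2 * z ^ 3 - 1`
      1 < c ∧
      (c⁻¹) ^ 4 + 2 * (c⁻¹) ^ 3 - 1 = 0 ∧
      (∀ z : ℂ, z ^ 4 + 2 * z ^ 3 - 1 = 0 → z ≠ ((c⁻¹ : ℝ) : ℂ) → c⁻¹ < ‖z‖) ∧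
      (1.3953 < c ∧ c < 1.3954) ∧
      (1.1812 < √c ∧ √c < 1.1813) ∧
      -- the run from `C₀` along the green edge exists, takes `T n` steps, and ends in `C₁`;
      -- and it is the only one
      (∀ n : ℕ, 3 ≤ n →
        ∃ p : ℕ → List (Fin (2 * n + 6)),
          Thomason.IsRun (Thomason.G n) (Thomason.C₀ n) (Thomason.lam n) (Thomason.greenEnd n)
            (T n) p ∧
          Thomason.cycleEdges (p (T n)) = Thomason.C₁ n ∧
          ∀ (T' : ℕ) (p' : ℕ → List (Fin (2 * n + 6))),
            Thomason.IsRun (Thomason.G n) (Thomason.C₀ n) (Thomason.lam n) (Thomason.greenEnd n)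
              T' p' →
            T' = T n ∧ ∀ k ≤ T n, p' k = p k) ∧
      -- the number of steps, in terms of `n` and in terms of the number of vertices
      (fun n : ℕ => (T n : ℝ)) =Θ[atTop] (fun n : ℕ => c ^ n) ∧
      (fun n : ℕ => (T n : ℝ)) =Θ[atTop]
        (fun n : ℕ => √c ^ Fintype.card (Fin (2 * n + 6))) := by
  refine ⟨fun n hn => ⟨Thomason.isRegularOfDegree_G (by omega), Thomason.isThreeConnected_G n,
    Thomason.isPlanar_G n⟩, ?_⟩
  obtain ⟨c, hlo, hhi, hc4⟩ := Thomason.exists_growth_rate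
  have hc1 : 1 < c := by linarith
  have hc0 : 0 < c := by linarith
  -- This is `c ^ 4 = 2 * c + 1` divided by `c ^ 4`.
  have hroot : (c⁻¹) ^ 4 + 2 * (c⁻¹) ^ 3 - 1 = 0 := by
    field_simp
    linarith
  have htheta := Thomason.stepsA_isTheta hc1 hc4
  refine ⟨c, Thomason.stepsA, hc1, hroot,
    fun z hz hne => Thomason.lt_norm_of_root (inv_pos.2 hc0) hroot hz hne, ⟨hlo, hhi⟩,
    ⟨Real.lt_sqrt_of_sq_lt (by norm_num; linarith), (Real.sqrt_lt' (by norm_num)).2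
      (by norm_num; linarith)⟩, fun n hn => ?_, htheta, ?_⟩
  · obtain ⟨p, hp, hpC⟩ := Thomason.exists_isRun n
    exact ⟨p, hp, hpC, fun T' p' hp' => hp.unique (Thomason.isRegularOfDegree_G (by omega)) hp'⟩
  · refine htheta.trans ?_
    have : (fun n : ℕ => √c ^ Fintype.card (Fin (2 * n + 6))) = fun n : ℕ => c ^ 3 * c ^ n := by
      funext n
      rw [Fintype.card_fin, show 2 * n + 6 = 2 * (3 + n) by ring, pow_mul, Real.sq_sqrt hc0.le,
        pow_add]
    rw [this]
    exact (isTheta_const_mul_left (pow_pos hc0 3).ne').2 (isTheta_refl _ _) |>.symm
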